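/- Let $S$ be an inverse semigroup (write $E(S)$ for its set of idempotents, $s^*$ for the inverse of $s$, and $s\le t$ if $s=te$ for some $e\in E(S)$). Let $X$ be a non-empty locally compact Hausdorff zero-dimensional space, and let $\theta=(\{\theta_s\}_{s\in S},\{X_s\}_{s\in S})$ be an action of $S$ on $X$: a semigroup homomorphism $s\mapsto(\theta_s\colon X_{s^*}\to X_s)$ from $S$ to the inverse monoid of homeomorphisms between open subsets of $X$, such that $X=\bigcup_{s\in S}X_s$. The groupoid of germs $S\ltimes X$ has unit space $X$ and as arrows the classes $[s,x]$ of pairs $(s,x)$ with $x\in X_{s^*}$, where $[s,x]=[t,y]$ if and only if $x=y$ and there is $u\le s,t$ with $x\in X_{u^*}$. Its structure is $\boldsymbol d([s,x])=x$, $\boldsymbol r([s,x])=\theta_s(x)$, $[s,\theta_t(x)][t,x]=[st,x]$, $[s,x]^{-1}=[s^*,\theta_s(x)]$, and the sets $\{[s,x]\mid x\in U\}$, for $s\in S$ and $U\subseteq X_{s^*}$ open, form a basis of its topology. Write $\mathscr G=S\ltimes X$. A $\mathscr G$-sheaf of fields $\mathcal O$ consists of a space $E$, a local homeomorphism $p\colon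 E\to X$, a field structure on each stalk $\mathcal O_x=p^{-1}(x)$ such that the fibrewise addition and multiplication $E\times_{p,p}E\to E$ and the unit section $x\mapsto 1_x$ are continuous, and a continuous map $(\gamma,e)\mapsto\alpha_\gamma(e)$, defined for $\boldsymbol d(\gamma)=p(e)$ and with values in $E$, that restricts to ring homomorphisms $\alpha_\gamma\colon\mathcal O_{\boldsymbol d(\gamma)}\to\mathcal O_{\boldsymbol r(\gamma)}$ with $\alpha_x=\mathrm{id}$ for units $x$ and $\alpha_\beta\circ\alpha_\gamma=\alpha_{\beta\gamma}$ whenever $\boldsymbol d(\beta)=\boldsymbol r(\gamma)$. The ring $\Gamma_c(\mathscr G,\mathcal O)$ is the additive group generated by the maps $f\colon\mathscr G\to E$ with $p\circ f=\boldsymbol r$ for which there is a compact open bisection $U$ such that $f$ is continuous on $U$ and $f(\gamma)=0$ for $\gamma\notin U$. Its operations are pointwise addition and the convolution $(f*g)(\gamma)=\sum_{\beta\rho=\gamma}f(\beta)\,\alpha_\beta(g(\rho))$. **Theorem.** Suppose that $\theta$ is topologically free, i.e. for every $s\in S$ the interior of $\{x\in X_{s^*}\mid\theta_s(x)=x\}$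 equals $\{x\in X_{s^*}\mid x\in X_e\text{ for some }e\in E(S)\text{ with }e\le s\}$, and that $S\ltimes X$ is Hausdorff. Let $\mathcal O$ be an $S\ltimes X$-sheaf of fields. Then $\theta$ is minimal (the only open subsets $U\subseteq X$ with $\theta_s(U\cap X_{s^*})\subseteq U$ for all $s\in S$ are $\emptyset$ and $X$) if and only if the ring $\Gamma_c(S\ltimes X,\mathcal O)$ is simple (it is nonzero, and its only two-sided ideals are $0$ and itself). -/

import Mathlib

open Set Topology

/-- An inverse semigroup: every `s` has a unique (generalized) inverse `s⁻¹`, usually written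
`s*`, with `s s* s = s` and `s* s s* = s*`. -/
class InverseSemigroup (S : Type*) extends Semigroup S, Inv S where
  mul_inv_mul : ∀ s : S, s * s⁻¹ * s = s
  inv_mul_inv : ∀ s : S, s⁻¹ * s * s⁻¹ = s⁻¹
  inv_unique : ∀ s t : S, s * t * s = s → t * s * t = t → t = s⁻¹

namespace InverseSemigroup

variable {S : Type*} [InverseSemigroup S]

/-- The natural partial order: `s ≤ t` iff `s = t e` for some idempotent `e`. -/
def NatLE (s t : S) : Prop := ∃ e : S, IsIdempotentElem e ∧ s = t * e

theorem natLE_refl (s : S) : NatLE s s :=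
  ⟨s⁻¹ * s, by simp only [IsIdempotentElem, ← mul_assoc, inv_mul_inv],
    by rw [← mul_assoc, mul_inv_mul]⟩

theorem idem_inv {e : S} (he : IsIdempotentElem e) : e⁻¹ = e :=
  (inv_unique e e (by rw [he, he]) (by rw [he, he])).symm

theorem inv_inv' (s : S) : s⁻¹⁻¹ = s :=
  (inv_unique s⁻¹ s (inv_mul_inv s) (mul_inv_mul s)).symm

theorem idem_mul {e f : S} (he : IsIdempotentElem e) (hf : IsIdempotentElem f) :
    IsIdempotentElem (e * f) := by
  have he' : ∀ a, e * (e * a) = e * a := fun a => by rw [← mul_assoc, he]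
  have hf' : ∀ a, f * (f * a) = f * a := fun a => by rw [← mul_assoc, hf]
  set x := (e * f)⁻¹ with hx
  have h1 : ∀ a, e * (f * (x * (e * (f * a)))) = e * (f * a) := fun a => by
    have := congrArg (· * a) (mul_inv_mul (e * f))
    simpa only [mul_assoc] using this
  have h1' : e * (f * (x * (e * f))) = e * f := by
    simpa only [mul_assoc] using mul_inv_mul (e * f)
  have h2 : ∀ a, x * (e * (f * (x * a))) = x * a := fun a => by
    have := congrArg (· * a) (inv_mul_inv (e * f))
    simpa only [mul_assoc] using this
  have hxe : f * x * e = x := by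
    refine inv_unique (e * f) _ ?_ ?_
    · simp only [mul_assoc, he', hf', h1']
    · simp only [mul_assoc, he', hf', h2]
  have hxi : IsIdempotentElem x := by
    have : x * x = f * x * e * (f * x * e) := by rw [hxe]
    simp only [mul_assoc, h2] at this
    simp only [mul_assoc] at hxe
    rw [IsIdempotentElem, this, hxe]
  have : x = e * f := by rw [← idem_inv hxi, hx, inv_inv']
  rwa [← this]

theorem idem_comm {e f : S} (he : IsIdempotentElem e) (hf : IsIdempotentElem f) :
    e * f = f * e := by
  have he' : ∀ a, e * (e * a) = e * a := fun a => by rw [← mul_assoc, he]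
  have hf' : ∀ a, f * (f * a) = f * a := fun a => by rw [← mul_assoc, hf]
  have h1 : e * (f * (e * f)) = e * f := by
    simpa only [IsIdempotentElem, mul_assoc] using idem_mul he hf
  have h2 : f * (e * (f * e)) = f * e := by
    simpa only [IsIdempotentElem, mul_assoc] using idem_mul hf he
  have := inv_unique (e * f) (f * e) (by simp only [mul_assoc, he', hf', h1])
    (by simp only [mul_assoc, he', hf', h2])
  rw [this, idem_inv (idem_mul he hf)]

theorem idem_inv_mul (s : S) : IsIdempotentElem (s⁻¹ * s) := by
  simp only [IsIdempotentElem, ← mul_assoc, inv_mul_inv]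

theorem idem_mul_inv (s : S) : IsIdempotentElem (s * s⁻¹) := by
  simp only [IsIdempotentElem, ← mul_assoc, mul_inv_mul]

/-- `e t = t (t* e t)`, and `t* e t` is idempotent. -/
theorem idem_mul_eq {e : S} (he : IsIdempotentElem e) (t : S) :
    IsIdempotentElem (t⁻¹ * e * t) ∧ e * t = t * (t⁻¹ * e * t) := by
  have h : e * t = t * (t⁻¹ * e * t) := by
    calc e * t = e * (t * t⁻¹ * t) := by rw [mul_inv_mul]
      _ = (e * (t * t⁻¹)) * t := by simp only [mul_assoc]
      _ = ((t * t⁻¹) * e) * t := by rw [idem_comm he (idem_mul_inv t)]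
      _ = _ := by simp only [mul_assoc]
  refine ⟨?_, h⟩
  calc t⁻¹ * e * t * (t⁻¹ * e * t) = t⁻¹ * e * (t * (t⁻¹ * e * t)) := by simp only [mul_assoc]
    _ = t⁻¹ * (e * e) * t := by rw [← h]; simp only [mul_assoc]
    _ = t⁻¹ * e * t := by rw [he]

theorem NatLE.trans {s t u : S} (h : NatLE s t) (h' : NatLE t u) : NatLE s u := by
  obtain ⟨e, he, rfl⟩ := h
  obtain ⟨f, hf, rfl⟩ := h'
  exact ⟨f * e, idem_mul hf he, by rw [mul_assoc]⟩

theorem NatLE.mul {s t s' t' : S} (h : NatLE s s') (h' : NatLE t t') :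
    NatLE (s * t) (s' * t') := by
  obtain ⟨e, he, rfl⟩ := h
  obtain ⟨f, hf, rfl⟩ := h'
  obtain ⟨h1, h2⟩ := idem_mul_eq he t'
  refine ⟨t'⁻¹ * e * t' * f, idem_mul h1 hf, ?_⟩
  calc s' * e * (t' * f) = s' * (e * t') * f := by simp only [mul_assoc]
    _ = _ := by rw [h2]; simp only [mul_assoc]

theorem mul_inv_rev' (s t : S) : (s * t)⁻¹ = t⁻¹ * s⁻¹ := by
  have hc : (t * t⁻¹) * (s⁻¹ * s) = (s⁻¹ * s) * (t * t⁻¹) :=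
    idem_comm (idem_mul_inv t) (idem_inv_mul s)
  refine (inv_unique _ _ ?_ ?_).symm
  · calc s * t * (t⁻¹ * s⁻¹) * (s * t) = s * ((t * t⁻¹) * (s⁻¹ * s)) * t := by
          simp only [mul_assoc]
      _ = (s * s⁻¹ * s) * (t * t⁻¹ * t) := by rw [hc]; simp only [mul_assoc]
      _ = s * t := by rw [mul_inv_mul, mul_inv_mul]
  · calc t⁻¹ * s⁻¹ * (s * t) * (t⁻¹ * s⁻¹) = t⁻¹ * ((s⁻¹ * s) * (t * t⁻¹)) * s⁻¹ := by
          simp only [mul_assoc]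
      _ = (t⁻¹ * t * t⁻¹) * (s⁻¹ * s * s⁻¹) := by rw [← hc]; simp only [mul_assoc]
      _ = t⁻¹ * s⁻¹ := by rw [inv_mul_inv, inv_mul_inv]

theorem NatLE.inv {s t : S} (h : NatLE s t) : NatLE s⁻¹ t⁻¹ := by
  obtain ⟨e, he, rfl⟩ := h
  rw [mul_inv_rev', idem_inv he]
  obtain ⟨h1, h2⟩ := idem_mul_eq he t⁻¹
  exact ⟨_, h1, h2⟩

theorem natLE_of_mul_idem {e : S} (s : S) (he : IsIdempotentElem e) : NatLE (s * e) s :=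
  ⟨e, he, rfl⟩

end InverseSemigroup

open InverseSemigroup

/-- An action `θ` of an inverse semigroup `S` on a topological space `X`: a semigroup homomorphism
`s ↦ θ_s` from `S` to the inverse monoid of partial homeomorphisms between open subsets of `X`
(`θ_{st}` is `θ_s ∘ θ_t` on its largest domain of definition, and `≈` is equality of partial maps),
such that the domains of the `θ_s` cover `X`. The domain `(θ s).source` is `X_{s*}` and the range
`(θ s).target` is `X_s`. -/
structure InvSemigroupAction (S X : Type*) [InverseSemigroup S] [TopologicalSpace X] where
  θ : S → OpenPartialHomeomorph X X
  map_mul : ∀ s t : S, θ (s * t) ≈ (θ t).trans (θ s)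
  cover : ∀ x : X, ∃ s : S, x ∈ (θ s).source

namespace InvSemigroupAction

variable {S X : Type*} [InverseSemigroup S] [TopologicalSpace X] (A : InvSemigroupAction S X)

/-- Topological freeness: for all `s`, the interior of `{x ∈ X_{s*} | θ_s(x) = x}` is
`{x ∈ X_{s*} | x ∈ X_e for some idempotent e ≤ s}`. -/
def IsTopologicallyFree : Prop :=
  ∀ s : S, interior {x | x ∈ (A.θ s).source ∧ A.θ s x = x} =
    {x | x ∈ (A.θ s).source ∧ ∃ e : S, IsIdempotentElem e ∧ NatLE e s ∧ x ∈ (A.θ e).target}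

/-- A subset `U` of `X` is invariant if `θ_s(U ∩ X_{s*}) ⊆ U` for all `s`. -/
def IsInvariant (U : Set X) : Prop :=
  ∀ s : S, A.θ s '' (U ∩ (A.θ s).source) ⊆ U

/-- The action is minimal if the only open invariant subsets of `X` are `∅` and `X`. -/
def IsMinimal : Prop :=
  ∀ U : Set X, IsOpen U → A.IsInvariant U → U = ∅ ∨ U = univ

theorem mem_source_mul {s t : S} {x : X} :
    x ∈ (A.θ (s * t)).source ↔ x ∈ (A.θ t).source ∧ A.θ t x ∈ (A.θ s).source := by
  rw [(A.map_mul s t).source_eq, OpenPartialHomeomorph.trans_source]; rfl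

theorem apply_mul {s t : S} {x : X} (h : x ∈ (A.θ (s * t)).source) :
    A.θ (s * t) x = A.θ s (A.θ t x) :=
  (A.map_mul s t).eqOn h

theorem apply_idem {e : S} (he : IsIdempotentElem e) {x : X} (h : x ∈ (A.θ e).source) :
    A.θ e x = x := by
  have h' : x ∈ (A.θ (e * e)).source := by rwa [he]
  have h1 := A.apply_mul h'
  rw [he] at h1
  exact ((A.θ e).injOn h (A.mem_source_mul.1 h').2 h1).symm

theorem mem_of_le {u s : S} (h : NatLE u s) {x : X} (hx : x ∈ (A.θ u).source) :
    x ∈ (A.θ s).source ∧ A.θ u x = A.θ s x := by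
  obtain ⟨e, he, rfl⟩ := h
  have h1 := A.mem_source_mul.1 hx
  have h2 := A.apply_mul hx
  rw [A.apply_idem he h1.1] at h1 h2
  exact ⟨h1.2, h2⟩

theorem inv_apply {s : S} {x : X} (hx : x ∈ (A.θ s).source) :
    A.θ s x ∈ (A.θ s⁻¹).source ∧ A.θ s⁻¹ (A.θ s x) = x := by
  have h : x ∈ (A.θ (s * s⁻¹ * s)).source := by rwa [mul_inv_mul]
  have h1 := A.mem_source_mul.1 h
  have h2 := A.mem_source_mul.1 h1.2
  have h3 := A.apply_mul h
  rw [A.apply_mul h1.2, mul_inv_mul] at h3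
  exact ⟨h2.1, ((A.θ s).injOn hx h2.2 h3).symm⟩

/-- Representatives of germs: pairs `(s, x)` with `x ∈ X_{s*}`. -/
def PreGerm : Type _ := {q : S × X // q.2 ∈ (A.θ q.1).source}

/-- `(s, x) ∼ (t, y)` iff `x = y` and there is `u ≤ s, t` with `x ∈ X_{u*}`. -/
def germRel (a b : A.PreGerm) : Prop :=
  a.1.2 = b.1.2 ∧ ∃ u : S, NatLE u a.1.1 ∧ NatLE u b.1.1 ∧ a.1.2 ∈ (A.θ u).source

theorem germRel_equivalence : Equivalence A.germRel where
  refl a := ⟨rfl, a.1.1, natLE_refl _, natLE_refl _, a.2⟩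
  symm := by
    rintro a b ⟨h, u, h1, h2, h3⟩
    exact ⟨h.symm, u, h2, h1, h ▸ h3⟩
  trans := by
    rintro ⟨⟨s, x⟩, hs⟩ ⟨⟨t, y⟩, ht⟩ ⟨⟨w, z⟩, hw⟩ ⟨h, u, h1, h2, h3⟩ ⟨h', v, h1', h2', h3'⟩
    dsimp only at *
    subst h h'
    refine ⟨rfl, ?_⟩
    obtain ⟨e, he, rfl⟩ := h2
    obtain ⟨f, hf, rfl⟩ := h1'
    refine ⟨t * e * f, (natLE_of_mul_idem _ hf).trans h1, ?_, ?_⟩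
    · rw [mul_assoc, idem_comm he hf, ← mul_assoc]
      exact (natLE_of_mul_idem _ he).trans h2'
    · have := (A.mem_source_mul.1 h3').1
      rw [A.mem_source_mul, A.apply_idem hf this]
      exact ⟨this, h3⟩

instance germSetoid : Setoid A.PreGerm := ⟨A.germRel, A.germRel_equivalence⟩

/-- The arrow space of the groupoid of germs `S ⋉ X`. -/
def Germ : Type _ := Quotient A.germSetoid

/-- The germ `[s, x]`, for `x ∈ X_{s*}`. -/
def germ (s : S) (x : X) (h : x ∈ (A.θ s).source) : A.Germ :=
  Quotient.mk A.germSetoid ⟨(s, x), h⟩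

theorem germ_eq {s t : S} {x y : X} {h : x ∈ (A.θ s).source} {h' : y ∈ (A.θ t).source} :
    A.germ s x h = A.germ t y h' ↔
      x = y ∧ ∃ u : S, NatLE u s ∧ NatLE u t ∧ x ∈ (A.θ u).source :=
  Quotient.eq (r := A.germSetoid)

theorem germ_eq_of_le {u s : S} (hu : NatLE u s) {x : X} (hx : x ∈ (A.θ u).source) :
    A.germ u x hx = A.germ s x (A.mem_of_le hu hx).1 :=
  A.germ_eq.2 ⟨rfl, u, natLE_refl u, hu, hx⟩

theorem germ_ind {P : A.Germ → Prop} (h : ∀ s x hx, P (A.germ s x hx)) (γ : A.Germ) : P γ :=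
  Quotient.inductionOn γ fun a => h a.1.1 a.1.2 a.2

namespace Germ

/-- The source `d([s, x]) = x`. -/
def d : A.Germ → X := Quotient.lift (fun a => a.1.2) fun _ _ h => h.1

/-- The range `r([s, x]) = θ_s(x)`. -/
def r : A.Germ → X := Quotient.lift (fun a => A.θ a.1.1 a.1.2) (by
  rintro ⟨⟨s, x⟩, hs⟩ ⟨⟨t, y⟩, ht⟩ ⟨h, u, h1, h2, h3⟩
  dsimp only at *
  subst h
  rw [← (A.mem_of_le h1 h3).2, (A.mem_of_le h2 h3).2])

/-- The inverse `[s, x]⁻¹ = [s*, θ_s(x)]`. -/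
def inv : A.Germ → A.Germ := Quotient.lift
  (fun a => A.germ a.1.1⁻¹ (A.θ a.1.1 a.1.2) (A.inv_apply a.2).1) (by
  rintro ⟨⟨s, x⟩, hs⟩ ⟨⟨t, y⟩, ht⟩ ⟨h, u, h1, h2, h3⟩
  dsimp only at *
  subst h
  rw [A.germ_eq]
  refine ⟨by rw [← (A.mem_of_le h1 h3).2, (A.mem_of_le h2 h3).2], u⁻¹, h1.inv, h2.inv, ?_⟩
  rw [← (A.mem_of_le h1 h3).2]
  exact (A.inv_apply h3).1)

open Classical in
/-- The product `[s, θ_t(x)] [t, x] = [st, x]` (with an irrelevant value on pairs that are not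
composable). -/
noncomputable def mul : A.Germ → A.Germ → A.Germ := Quotient.lift₂
  (fun a b => if h : a.1.2 = A.θ b.1.1 b.1.2 then
      A.germ (a.1.1 * b.1.1) b.1.2 (A.mem_source_mul.2 ⟨b.2, h ▸ a.2⟩)
    else A.germ b.1.1 b.1.2 b.2) (by
  rintro ⟨⟨s, x⟩, hs⟩ ⟨⟨t, y⟩, ht⟩ ⟨⟨s', x'⟩, hs'⟩ ⟨⟨t', y'⟩, ht'⟩
    ⟨h, u, h1, h2, h3⟩ ⟨k, v, k1, k2, k3⟩
  dsimp only at *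
  subst h k
  have e1 := (A.mem_of_le k1 k3).2
  have e2 := (A.mem_of_le k2 k3).2
  by_cases h : x = A.θ t y
  · have h' : x = A.θ t' y := by rw [h, ← e1, e2]
    rw [dif_pos h, dif_pos h', A.germ_eq]
    refine ⟨rfl, u * v, h1.mul k1, h2.mul k2, A.mem_source_mul.2 ⟨k3, ?_⟩⟩
    rw [e1, ← h]
    exact h3
  · have h' : x ≠ A.θ t' y := by rwa [← e2, e1]
    rw [dif_neg h, dif_neg h', A.germ_eq]
    exact ⟨rfl, v, k1, k2, k3⟩)

/-- The unit at `x`: the germ `[e, x]`, for any idempotent `e` with `x ∈ X_e`. -/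
noncomputable def unit (x : X) : A.Germ :=
  A.germ ((A.cover x).choose⁻¹ * (A.cover x).choose) x (A.mem_source_mul.2
    ⟨(A.cover x).choose_spec, (A.inv_apply (A.cover x).choose_spec).1⟩)

@[simp] theorem d_germ {s : S} {x : X} (h : x ∈ (A.θ s).source) : d A (A.germ s x h) = x := rfl

@[simp] theorem r_germ {s : S} {x : X} (h : x ∈ (A.θ s).source) :
    r A (A.germ s x h) = A.θ s x := rfl

theorem inv_germ {s : S} {x : X} (h : x ∈ (A.θ s).source) :
    inv A (A.germ s x h) = A.germ s⁻¹ (A.θ s x) (A.inv_apply h).1 := rfl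

theorem mul_germ {s t : S} {x : X} (h : x ∈ (A.θ t).source) (h' : A.θ t x ∈ (A.θ s).source) :
    mul A (A.germ s (A.θ t x) h') (A.germ t x h) =
      A.germ (s * t) x (A.mem_source_mul.2 ⟨h, h'⟩) := dif_pos rfl

theorem unit_eq {e : S} (he : IsIdempotentElem e) {x : X} (hx : x ∈ (A.θ e).source) :
    unit A x = A.germ e x hx := by
  have hf := idem_inv_mul (A.cover x).choose
  have hx' := (A.mem_source_mul (s := (A.cover x).choose⁻¹) (t := (A.cover x).choose)).2
    ⟨(A.cover x).choose_spec, (A.inv_apply (A.cover x).choose_spec).1⟩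
  refine A.germ_eq.2 ⟨rfl, _ * e, natLE_of_mul_idem _ he, ?_, A.mem_source_mul.2 ⟨hx, ?_⟩⟩
  · rw [idem_comm hf he]
    exact natLE_of_mul_idem _ hf
  · rwa [A.apply_idem he hx]

theorem exists_unit_eq (x : X) : ∃ (e : S) (_ : IsIdempotentElem e) (hx : x ∈ (A.θ e).source),
    unit A x = A.germ e x hx :=
  ⟨_, idem_inv_mul _, _, rfl⟩

end Germ

/-- The set of germs `(s, U) = {[s, x] | x ∈ U}`. -/
def germSet (s : S) (U : Set X) : Set A.Germ :=
  {γ | ∃ (x : X) (h : x ∈ (A.θ s).source), x ∈ U ∧ γ = A.germ s x h}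

/-- The topology on the space of germs, with basis the sets `(s, U)`, for `U ⊆ X_{s*}` open. -/
instance : TopologicalSpace A.Germ :=
  TopologicalSpace.generateFrom
    {W | ∃ (s : S) (U : Set X), IsOpen U ∧ U ⊆ (A.θ s).source ∧ W = A.germSet s U}

theorem isOpen_germSet (s : S) {U : Set X} (hU : IsOpen U) : IsOpen (A.germSet s U) := by
  refine TopologicalSpace.isOpen_generateFrom_of_mem
    ⟨s, U ∩ (A.θ s).source, hU.inter (A.θ s).open_source, inter_subset_right, ?_⟩
  ext γ
  constructor
  · rintro ⟨x, h, hx, rfl⟩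
    exact ⟨x, h, ⟨hx, h⟩, rfl⟩
  · rintro ⟨x, h, hx, rfl⟩
    exact ⟨x, h, hx.1, rfl⟩

theorem isOpen_germ_iff {W : Set A.Germ} :
    IsOpen W ↔ ∀ s x hx, A.germ s x hx ∈ W → ∃ U : Set X, IsOpen U ∧ x ∈ U ∧
      A.germSet s U ⊆ W := by
  constructor
  · intro hW
    induction hW with
    | basic V hV =>
      obtain ⟨t, U, hU, hUt, rfl⟩ := hV
      rintro s x hx ⟨y, hy, hyU, h⟩
      obtain ⟨rfl, u, h1, h2, h3⟩ := A.germ_eq.1 h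
      refine ⟨U ∩ (A.θ u).source, hU.inter (A.θ u).open_source, ⟨hyU, h3⟩, ?_⟩
      rintro _ ⟨z, hz, ⟨hzU, hzu⟩, rfl⟩
      exact ⟨z, (A.mem_of_le h2 hzu).1, hzU, by
        rw [← A.germ_eq_of_le h1 hzu, A.germ_eq_of_le h2 hzu]⟩
    | univ => exact fun s x hx _ => ⟨Set.univ, isOpen_univ, trivial, Set.subset_univ _⟩
    | inter V W _ _ ihV ihW =>
      rintro s x hx ⟨h1, h2⟩
      obtain ⟨U, hU, hxU, hUV⟩ := ihV s x hx h1
      obtain ⟨U', hU', hxU', hUV'⟩ := ihW s x hx h2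
      refine ⟨U ∩ U', hU.inter hU', ⟨hxU, hxU'⟩, ?_⟩
      rintro _ ⟨z, hz, ⟨hz1, hz2⟩, rfl⟩
      exact ⟨hUV ⟨z, hz, hz1, rfl⟩, hUV' ⟨z, hz, hz2, rfl⟩⟩
    | sUnion T _ ih =>
      rintro s x hx ⟨V, hV, hxV⟩
      obtain ⟨U, hU, hxU, hUV⟩ := ih V hV s x hx hxV
      exact ⟨U, hU, hxU, hUV.trans (Set.subset_sUnion_of_mem hV)⟩
  · intro h
    rw [isOpen_iff_forall_mem_open]
    refine A.germ_ind ?_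
    intro s x hx hW
    obtain ⟨U, hU, hxU, hUW⟩ := h s x hx hW
    exact ⟨_, hUW, A.isOpen_germSet s hU, x, hx, hxU, rfl⟩

namespace Germ

theorem continuous_d : Continuous (d A) := by
  refine ⟨fun V hV => A.isOpen_germ_iff.2 fun s x hx hxV => ⟨V, hV, hxV, ?_⟩⟩
  rintro _ ⟨z, hz, hzV, rfl⟩
  exact hzV

theorem isOpenMap_d : IsOpenMap (d A) := by
  intro W hW
  rw [isOpen_iff_forall_mem_open]
  rintro _ ⟨γ, hγ, rfl⟩
  revert γ
  refine A.germ_ind ?_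
  intro s x hx hW'
  obtain ⟨U, hU, hxU, hUW⟩ := A.isOpen_germ_iff.1 hW s x hx hW'
  refine ⟨U ∩ (A.θ s).source, ?_, hU.inter (A.θ s).open_source, hxU, hx⟩
  rintro z ⟨hzU, hz⟩
  exact ⟨A.germ s z hz, hUW ⟨z, hz, hzU, rfl⟩, rfl⟩

theorem injOn_d (s : S) (U : Set X) : InjOn (d A) (A.germSet s U) := by
  rintro _ ⟨x, hx, -, rfl⟩ _ ⟨y, hy, -, rfl⟩ h
  change x = y at h
  subst h
  rfl

theorem isLocalHomeomorph_d : IsLocalHomeomorph (d A) := by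
  rw [isLocalHomeomorph_iff_isOpenEmbedding_restrict]
  refine A.germ_ind ?_
  intro s x hx
  have hO : IsOpen (A.germSet s univ) := A.isOpen_germSet s isOpen_univ
  refine ⟨A.germSet s univ, hO.mem_nhds ⟨x, hx, trivial, rfl⟩, ?_⟩
  exact .of_continuous_injective_isOpenMap ((continuous_d A).comp continuous_subtype_val)
    (injOn_iff_injective.1 (injOn_d A s univ)) ((isOpenMap_d A).domRestrict hO)

theorem inv_inv (γ : A.Germ) : inv A (inv A γ) = γ := by
  revert γ
  refine A.germ_ind ?_
  intro s x hx
  rw [inv_germ, inv_germ, A.germ_eq]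
  refine ⟨(A.inv_apply hx).2, s, ?_, natLE_refl s, ?_⟩
  · rw [inv_inv']; exact natLE_refl s
  · rwa [(A.inv_apply hx).2]

theorem r_inv (γ : A.Germ) : r A (inv A γ) = d A γ := by
  revert γ
  exact A.germ_ind fun s x hx => (A.inv_apply hx).2

theorem d_inv (γ : A.Germ) : d A (inv A γ) = r A γ := by
  revert γ
  exact A.germ_ind fun s x hx => rfl

theorem continuous_inv : Continuous (inv A) := by
  refine ⟨fun V hV => A.isOpen_germ_iff.2 fun s x hx hxV => ?_⟩
  obtain ⟨U, hU, hxU, hUV⟩ := A.isOpen_germ_iff.1 hV s⁻¹ (A.θ s x) (A.inv_apply hx).1 hxV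
  refine ⟨(A.θ s).source ∩ A.θ s ⁻¹' U, (A.θ s).isOpen_inter_preimage hU, ⟨hx, hxU⟩, ?_⟩
  rintro _ ⟨z, hz, ⟨-, hzU⟩, rfl⟩
  exact hUV ⟨_, (A.inv_apply hz).1, hzU, rfl⟩

theorem isLocalHomeomorph_r : IsLocalHomeomorph (r A) := by
  have : r A = d A ∘ inv A := funext fun γ => (d_inv A γ).symm
  rw [this]
  exact (isLocalHomeomorph_d A).comp (Homeomorph.isLocalHomeomorph
    ⟨⟨inv A, inv A, inv_inv A, inv_inv A⟩, continuous_inv A, continuous_inv A⟩)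

theorem continuous_unit : Continuous (unit A) := by
  refine ⟨fun V hV => ?_⟩
  rw [isOpen_iff_forall_mem_open]
  intro x hxV
  obtain ⟨e, he, hx, h⟩ := exists_unit_eq A x
  rw [mem_preimage, h] at hxV
  obtain ⟨U, hU, hxU, hUV⟩ := A.isOpen_germ_iff.1 hV e x hx hxV
  refine ⟨U ∩ (A.θ e).source, ?_, hU.inter (A.θ e).open_source, hxU, hx⟩
  rintro z ⟨hzU, hz⟩
  rw [mem_preimage, unit_eq A he hz]
  exact hUV ⟨z, hz, hzU, rfl⟩

/-- Induction over composable pairs of germs. -/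
theorem comp_ind {P : A.Germ → A.Germ → Prop}
    (H : ∀ s t x (h : x ∈ (A.θ t).source) (h' : A.θ t x ∈ (A.θ s).source),
      P (A.germ s (A.θ t x) h') (A.germ t x h)) (β γ : A.Germ) (hc : d A β = r A γ) :
    P β γ := by
  revert β γ
  refine A.germ_ind ?_
  intro s y hy
  refine A.germ_ind ?_
  intro t x hx hc
  change y = A.θ t x at hc
  subst hc
  exact H s t x hx hy

theorem continuousOn_mul :
    ContinuousOn (fun q : A.Germ × A.Germ => mul A q.1 q.2) {q | d A q.1 = r A q.2} := by
  rintro ⟨β, γ⟩ hc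
  revert hc
  refine comp_ind A (P := fun β γ => ContinuousWithinAt _ _ (β, γ)) ?_ β γ
  intro s t x h h'
  rw [ContinuousWithinAt, tendsto_nhds]
  intro V hV hxV
  rw [mul_germ] at hxV
  obtain ⟨U, hU, hxU, hUV⟩ := A.isOpen_germ_iff.1 hV _ _ _ hxV
  have hO : IsOpen (A.germSet s univ ×ˢ A.germSet t U) :=
    (A.isOpen_germSet s isOpen_univ).prod (A.isOpen_germSet t hU)
  refine Filter.mem_of_superset (inter_mem_nhdsWithin _ (hO.mem_nhds
    ⟨⟨_, h', trivial, rfl⟩, ⟨_, h, hxU, rfl⟩⟩)) ?_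
  rintro ⟨_, _⟩ ⟨hc, ⟨y, hy, -, rfl⟩, ⟨z, hz, hzU, rfl⟩⟩
  change y = A.θ t z at hc
  subst hc
  simp only [mem_preimage]
  rw [mul_germ]
  exact hUV ⟨z, _, hzU, rfl⟩

end Germ

end InvSemigroupAction

/-- An étale groupoid with unit space `X` and arrow space `G`, with source `d`, range `r` and
multiplication `mul β γ = βγ`, where only the values for `d(β) = r(γ)` matter. The unit space is
embedded in the arrow space by `unit`. -/
structure EtaleGroupoid (X G : Type*) [TopologicalSpace X] [TopologicalSpace G] where
  d : G → X
  r : G → X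
  unit : X → G
  inv : G → G
  mul : G → G → G
  d_unit : ∀ x, d (unit x) = x
  r_unit : ∀ x, r (unit x) = x
  d_inv : ∀ γ, d (inv γ) = r γ
  r_inv : ∀ γ, r (inv γ) = d γ
  d_mul : ∀ β γ, d β = r γ → d (mul β γ) = d γ
  r_mul : ∀ β γ, d β = r γ → r (mul β γ) = r β
  mul_assoc : ∀ α β γ, d α = r β → d β = r γ → mul (mul α β) γ = mul α (mul β γ)
  mul_unit : ∀ γ, mul γ (unit (d γ)) = γ
  unit_mul : ∀ γ, mul (unit (r γ)) γ = γ
  inv_mul : ∀ γ, mul (inv γ) γ = unit (d γ)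
  mul_inv : ∀ γ, mul γ (inv γ) = unit (r γ)
  isLocalHomeomorph_d : IsLocalHomeomorph d
  isLocalHomeomorph_r : IsLocalHomeomorph r
  continuous_unit : Continuous unit
  continuous_inv : Continuous inv
  continuousOn_mul : ContinuousOn (fun q : G × G => mul q.1 q.2) {q | d q.1 = r q.2}

/-- The groupoid of germs `S ⋉ X`. -/
noncomputable def InvSemigroupAction.groupoid {S X : Type*} [InverseSemigroup S]
    [TopologicalSpace X] (A : InvSemigroupAction S X) : EtaleGroupoid X A.Germ where
  d := Germ.d A
  r := Germ.r A
  unit := Germ.unit A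
  inv := Germ.inv A
  mul := Germ.mul A
  d_unit _ := rfl
  r_unit x := by
    obtain ⟨e, he, hx, h⟩ := Germ.exists_unit_eq A x
    rw [h]
    exact A.apply_idem he hx
  d_inv := Germ.d_inv A
  r_inv := Germ.r_inv A
  d_mul := Germ.comp_ind A fun s t x h h' => by rw [Germ.mul_germ]; rfl
  r_mul := Germ.comp_ind A fun s t x h h' => by
    rw [Germ.mul_germ]
    exact A.apply_mul (A.mem_source_mul.2 ⟨h, h'⟩)
  mul_assoc α β γ h1 h2 := by
    revert α β γ
    refine A.germ_ind fun s x hx => A.germ_ind fun t y hy => A.germ_ind fun u z hz h1 h2 => ?_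
    change x = A.θ t y at h1
    change y = A.θ u z at h2
    subst h2
    subst h1
    rw [Germ.mul_germ, Germ.mul_germ, Germ.mul_germ]
    have h1 : A.θ (t * u) z = A.θ t (A.θ u z) := A.apply_mul (A.mem_source_mul.2 ⟨hz, hy⟩)
    have h2 : A.germ s (A.θ t (A.θ u z)) hx = A.germ s (A.θ (t * u) z) (by rwa [h1]) :=
      A.germ_eq.2 ⟨h1.symm, s, natLE_refl s, natLE_refl s, hx⟩
    rw [h2, Germ.mul_germ, A.germ_eq]
    refine ⟨rfl, s * t * u, natLE_refl _, ?_, ?_⟩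
    · rw [_root_.mul_assoc]; exact natLE_refl _
    · simp only [A.mem_source_mul]
      exact ⟨hz, hy, hx⟩
  mul_unit := A.germ_ind fun s x hx => by
    have hx' : x ∈ (A.θ (s⁻¹ * s)).source := A.mem_source_mul.2 ⟨hx, (A.inv_apply hx).1⟩
    have hi : A.θ (s⁻¹ * s) x = x := A.apply_idem (idem_inv_mul s) hx'
    rw [Germ.d_germ, Germ.unit_eq A (idem_inv_mul s) hx']
    have : A.germ s x hx = A.germ s (A.θ (s⁻¹ * s) x) (by rwa [hi]) :=
      A.germ_eq.2 ⟨hi.symm, s, natLE_refl s, natLE_refl s, hx⟩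
    rw [this, Germ.mul_germ, ← this, A.germ_eq]
    refine ⟨rfl, s, ?_, natLE_refl s, hx⟩
    rw [← _root_.mul_assoc, mul_inv_mul]
    exact natLE_refl s
  unit_mul := A.germ_ind fun s x hx => by
    have hx' : A.θ s x ∈ (A.θ (s * s⁻¹)).source :=
      A.mem_source_mul.2 ⟨(A.inv_apply hx).1, by rwa [(A.inv_apply hx).2]⟩
    rw [Germ.r_germ, Germ.unit_eq A (idem_mul_inv s) hx', Germ.mul_germ, A.germ_eq]
    refine ⟨rfl, s, ?_, natLE_refl s, hx⟩
    rw [mul_inv_mul]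
    exact natLE_refl s
  inv_mul := A.germ_ind fun s x hx => by
    rw [Germ.inv_germ, Germ.mul_germ, Germ.d_germ, Germ.unit_eq A (idem_inv_mul s)]
  mul_inv := A.germ_ind fun s x hx => by
    have h := A.inv_apply hx
    have : A.germ s x hx = A.germ s (A.θ s⁻¹ (A.θ s x)) (by rwa [h.2]) :=
      A.germ_eq.2 ⟨h.2.symm, s, natLE_refl s, natLE_refl s, hx⟩
    have hx' : A.θ s x ∈ (A.θ (s * s⁻¹)).source :=
      A.mem_source_mul.2 ⟨(A.inv_apply hx).1, by rwa [(A.inv_apply hx).2]⟩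
    rw [Germ.inv_germ]
    conv_lhs => rw [this]
    rw [Germ.mul_germ, Germ.r_germ, Germ.unit_eq A (idem_mul_inv s) hx']
  isLocalHomeomorph_d := Germ.isLocalHomeomorph_d A
  isLocalHomeomorph_r := Germ.isLocalHomeomorph_r A
  continuous_unit := Germ.continuous_unit A
  continuous_inv := Germ.continuous_inv A
  continuousOn_mul := Germ.continuousOn_mul A

/-- A sheaf `p : E → X` on an étale groupoid (over a fixed total space `E`): `p` is a local
homeomorphism, and `act γ e = α_γ(e)`, where only the values for `d(γ) = p(e)` matter, is a
continuous action. -/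
structure GroupoidSheaf {X G : Type*} [TopologicalSpace X] [TopologicalSpace G]
    (𝒢 : EtaleGroupoid X G) (E : Type*) [TopologicalSpace E] where
  p : E → X
  isLocalHomeomorph_p : IsLocalHomeomorph p
  act : G → E → E
  continuousOn_act : ContinuousOn (fun q : G × E => act q.1 q.2) {q | 𝒢.d q.1 = p q.2}
  act_unit : ∀ e, act (𝒢.unit (p e)) e = e
  p_act : ∀ γ e, 𝒢.d γ = p e → p (act γ e) = 𝒢.r γ
  act_act : ∀ β γ e, 𝒢.d β = 𝒢.r γ → 𝒢.d γ = p e → act β (act γ e) = act (𝒢.mul β γ) e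

namespace GroupoidSheaf

variable {X G : Type*} [TopologicalSpace X] [TopologicalSpace G] {𝒢 : EtaleGroupoid X G}
  {E : Type*} [TopologicalSpace E]

/-- The stalk `p⁻¹(x)`. -/
abbrev Stalk (𝓔 : GroupoidSheaf 𝒢 E) (x : X) : Type _ := {e : E // 𝓔.p e = x}

/-- The map `α_γ` from the stalk at `d(γ)` to the stalk at `r(γ)`. -/
def actStalk (𝓔 : GroupoidSheaf 𝒢 E) (γ : G) (e : 𝓔.Stalk (𝒢.d γ)) : 𝓔.Stalk (𝒢.r γ) :=
  ⟨𝓔.act γ e.1, 𝓔.p_act γ e.1 e.2.symm⟩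

end GroupoidSheaf

/-- A sheaf of (unital) rings on an étale groupoid. -/
structure GroupoidSheafOfRings {X G : Type*} [TopologicalSpace X] [TopologicalSpace G]
    (𝒢 : EtaleGroupoid X G) (E : Type*) [TopologicalSpace E] extends GroupoidSheaf 𝒢 E where
  ring : ∀ x, Ring (toGroupoidSheaf.Stalk x)
  continuous_add : Continuous fun q : {q : E × E // p q.1 = p q.2} =>
    (((⟨q.1.1, q.2⟩ : toGroupoidSheaf.Stalk (p q.1.2)) + ⟨q.1.2, rfl⟩ :
      toGroupoidSheaf.Stalk (p q.1.2)) : E)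
  continuous_mul : Continuous fun q : {q : E × E // p q.1 = p q.2} =>
    (((⟨q.1.1, q.2⟩ : toGroupoidSheaf.Stalk (p q.1.2)) * ⟨q.1.2, rfl⟩ :
      toGroupoidSheaf.Stalk (p q.1.2)) : E)
  continuous_one : Continuous fun x => ((1 : toGroupoidSheaf.Stalk x) : E)
  act_add : ∀ γ (a b : toGroupoidSheaf.Stalk (𝒢.d γ)), toGroupoidSheaf.actStalk γ (a + b) =
    toGroupoidSheaf.actStalk γ a + toGroupoidSheaf.actStalk γ b
  act_mul : ∀ γ (a b : toGroupoidSheaf.Stalk (𝒢.d γ)), toGroupoidSheaf.actStalk γ (a * b) =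
    toGroupoidSheaf.actStalk γ a * toGroupoidSheaf.actStalk γ b
  act_one : ∀ γ, toGroupoidSheaf.actStalk γ 1 = 1

namespace EtaleGroupoid

variable {X G : Type*} [TopologicalSpace X] [TopologicalSpace G] (𝒢 : EtaleGroupoid X G)

/-- `U` is a compact open bisection: a compact open set of arrows on which `d` and `r` are
injective. (If `X` is Hausdorff then `U` is Hausdorff too, being homeomorphic to `d(U)`.) -/
def IsCompactOpenBisection (U : Set G) : Prop :=
  IsCompact U ∧ IsOpen U ∧ InjOn 𝒢.d U ∧ InjOn 𝒢.r U

theorem r_factor {β ρ γ : G} (h : 𝒢.d β = 𝒢.r ρ) (h' : 𝒢.mul β ρ = γ) : 𝒢.r β = 𝒢.r γ :=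
  (𝒢.r_mul β ρ h).symm.trans (congrArg 𝒢.r h')

variable {𝒢}

theorem inv_mul_cancel {β γ : G} (h : 𝒢.d β = 𝒢.r γ) : 𝒢.mul (𝒢.inv β) (𝒢.mul β γ) = γ := by
  rw [← 𝒢.mul_assoc _ _ _ (𝒢.d_inv β) h, 𝒢.inv_mul, h, 𝒢.unit_mul]

theorem mul_inv_cancel {β γ : G} (h : 𝒢.r β = 𝒢.r γ) : 𝒢.mul β (𝒢.mul (𝒢.inv β) γ) = γ := by
  rw [← 𝒢.mul_assoc _ _ _ (𝒢.r_inv β).symm (by rw [𝒢.d_inv, h]), 𝒢.mul_inv, h, 𝒢.unit_mul]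

/-- The product `UV` of two sets of arrows. -/
def setMul (𝒢 : EtaleGroupoid X G) (U V : Set G) : Set G :=
  {γ | ∃ β ∈ U, ∃ ρ ∈ V, 𝒢.d β = 𝒢.r ρ ∧ 𝒢.mul β ρ = γ}

/-- The restriction of `r` to an open set on which it is injective has a continuous inverse. -/
theorem exists_section {U : Set G} (hU : IsOpen U) (hi : InjOn 𝒢.r U) :
    ∃ b : X → G, (∀ β ∈ U, b (𝒢.r β) = β) ∧ ContinuousOn b (𝒢.r '' U) := by
  classical
  rcases U.eq_empty_or_nonempty with rfl | ⟨u, -⟩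
  · refine ⟨fun x => 𝒢.unit x, by simp, by simp⟩
  have : Nonempty G := ⟨u⟩
  have hb : ∀ β ∈ U, Function.invFunOn 𝒢.r U (𝒢.r β) = β := fun β hβ =>
    hi (Function.invFunOn_mem ⟨β, hβ, rfl⟩) hβ (Function.invFunOn_eq ⟨β, hβ, rfl⟩)
  refine ⟨Function.invFunOn 𝒢.r U, hb, ?_⟩
  rintro _ ⟨β, hβ, rfl⟩
  rw [ContinuousWithinAt, tendsto_nhds]
  intro W hW hbW
  rw [hb β hβ] at hbW
  have := 𝒢.isLocalHomeomorph_r.isOpenMap _ (hU.inter hW)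
  refine Filter.mem_of_superset (mem_nhdsWithin_of_mem_nhds (this.mem_nhds ⟨β, ⟨hβ, hbW⟩, rfl⟩)) ?_
  rintro _ ⟨ρ, ⟨hρ, hρW⟩, rfl⟩
  rw [mem_preimage, hb ρ hρ]
  exact hρW

/-- On `UV`, with `U` an open set on which `r` is injective, the factors depend continuously on the
product. -/
theorem exists_factor {U V : Set G} (hU : IsOpen U) (hi : InjOn 𝒢.r U) :
    ∃ b c : G → G, ContinuousOn b (𝒢.r ⁻¹' (𝒢.r '' U)) ∧ ContinuousOn c (𝒢.r ⁻¹' (𝒢.r '' U)) ∧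
      𝒢.setMul U V = 𝒢.r ⁻¹' (𝒢.r '' U) ∩ c ⁻¹' V ∧
      ∀ β ∈ U, ∀ ρ, 𝒢.d β = 𝒢.r ρ → b (𝒢.mul β ρ) = β ∧ c (𝒢.mul β ρ) = ρ := by
  obtain ⟨b, hb, hbc⟩ := 𝒢.exists_section hU hi
  have hrc := 𝒢.isLocalHomeomorph_r.continuous
  have hbc' : ContinuousOn (fun γ => b (𝒢.r γ)) (𝒢.r ⁻¹' (𝒢.r '' U)) :=
    hbc.comp hrc.continuousOn fun _ h => h
  have key : ∀ β ∈ U, ∀ ρ, 𝒢.d β = 𝒢.r ρ → b (𝒢.r (𝒢.mul β ρ)) = β ∧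
      𝒢.mul (𝒢.inv (b (𝒢.r (𝒢.mul β ρ)))) (𝒢.mul β ρ) = ρ := by
    intro β hβ ρ h
    rw [𝒢.r_mul β ρ h, hb β hβ, inv_mul_cancel h]
    exact ⟨rfl, rfl⟩
  refine ⟨fun γ => b (𝒢.r γ), fun γ => 𝒢.mul (𝒢.inv (b (𝒢.r γ))) γ, hbc', ?_, ?_, key⟩
  · refine 𝒢.continuousOn_mul.comp
      ((𝒢.continuous_inv.comp_continuousOn hbc').prodMk continuousOn_id) ?_
    rintro γ ⟨β, hβ, h⟩
    change 𝒢.d (𝒢.inv (b (𝒢.r γ))) = 𝒢.r γ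
    rw [𝒢.d_inv, ← h, hb β hβ]
  · ext γ
    constructor
    · rintro ⟨β, hβ, ρ, hρ, h, rfl⟩
      refine ⟨⟨β, hβ, (𝒢.r_mul β ρ h).symm⟩, ?_⟩
      rw [mem_preimage, (key β hβ ρ h).2]
      exact hρ
    · rintro ⟨⟨β, hβ, h⟩, hV⟩
      rw [mem_preimage, ← h, hb β hβ] at hV
      exact ⟨β, hβ, _, hV, by rw [𝒢.r_mul _ _ (by rw [𝒢.d_inv, h]), 𝒢.r_inv], mul_inv_cancel h⟩

theorem IsCompactOpenBisection.setMul [T2Space X] {U V : Set G} (hU : 𝒢.IsCompactOpenBisection U)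
    (hV : 𝒢.IsCompactOpenBisection V) : 𝒢.IsCompactOpenBisection (𝒢.setMul U V) := by
  obtain ⟨hUc, hUo, hUd, hUr⟩ := hU
  obtain ⟨hVc, hVo, hVd, hVr⟩ := hV
  have hdc := 𝒢.isLocalHomeomorph_d.continuous
  have hrc := 𝒢.isLocalHomeomorph_r.continuous
  refine ⟨?_, ?_, ?_, ?_⟩
  · have hcl : IsClosed {q : G × G | 𝒢.d q.1 = 𝒢.r q.2} :=
      isClosed_eq (hdc.comp continuous_fst) (hrc.comp continuous_snd)
    have := ((hUc.prod hVc).inter_right hcl).image_of_continuousOn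
      (𝒢.continuousOn_mul.mono inter_subset_right)
    convert this using 1
    ext γ
    constructor
    · rintro ⟨β, hβ, ρ, hρ, h, rfl⟩
      exact ⟨(β, ρ), ⟨⟨hβ, hρ⟩, h⟩, rfl⟩
    · rintro ⟨⟨β, ρ⟩, ⟨⟨hβ, hρ⟩, h⟩, rfl⟩
      exact ⟨β, hβ, ρ, hρ, h, rfl⟩
  · obtain ⟨b, c, -, hc, h, -⟩ := 𝒢.exists_factor (V := V) hUo hUr
    rw [h]
    exact hc.isOpen_inter_preimage
      ((𝒢.isLocalHomeomorph_r.isOpenMap _ hUo).preimage hrc) hVo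
  · rintro _ ⟨β, hβ, ρ, hρ, h, rfl⟩ _ ⟨β', hβ', ρ', hρ', h', rfl⟩ he
    rw [𝒢.d_mul _ _ h, 𝒢.d_mul _ _ h'] at he
    obtain rfl := hVd hρ hρ' he
    obtain rfl := hUd hβ hβ' (h.trans h'.symm)
    rfl
  · rintro _ ⟨β, hβ, ρ, hρ, h, rfl⟩ _ ⟨β', hβ', ρ', hρ', h', rfl⟩ he
    rw [𝒢.r_mul _ _ h, 𝒢.r_mul _ _ h'] at he
    obtain rfl := hUr hβ hβ' he
    obtain rfl := hVr hρ hρ' (h.symm.trans h')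
    rfl

end EtaleGroupoid

namespace GroupoidSheafOfRings

variable {X G : Type*} [TopologicalSpace X] [TopologicalSpace G] {𝒢 : EtaleGroupoid X G}
  {E : Type*} [TopologicalSpace E] (𝒪 : GroupoidSheafOfRings 𝒢 E)

/-- The stalk `𝒪_x`, a ring. -/
abbrev Stalk (x : X) : Type _ := 𝒪.toGroupoidSheaf.Stalk x

instance (x : X) : Ring (𝒪.Stalk x) := 𝒪.ring x

/-- `𝒪` is a sheaf of fields if all its stalks are fields. -/
def IsSheafOfFields : Prop := ∀ x, IsField (𝒪.Stalk x)

/-- The action of `γ` as a ring homomorphism from the stalk at `d(γ)` to the stalk at `r(γ)`. -/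
def actHom (γ : G) : 𝒪.Stalk (𝒢.d γ) →+* 𝒪.Stalk (𝒢.r γ) :=
  RingHom.mk' ⟨⟨𝒪.actStalk γ, 𝒪.act_one γ⟩, 𝒪.act_mul γ⟩ (𝒪.act_add γ)

/-- The identification of the stalks at `x` and `y` when `x = y`. -/
def castHom {x y : X} (h : x = y) : 𝒪.Stalk x →+* 𝒪.Stalk y where
  toFun e := ⟨e.1, e.2.trans h⟩
  map_one' := by subst h; rfl
  map_mul' a b := by subst h; rfl
  map_zero' := by subst h; rfl
  map_add' a b := by subst h; rfl

/-- The abelian group (under pointwise addition) of all maps `f` from the arrow space to `E` with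
`f(γ) ∈ 𝒪_{r(γ)}` for all `γ`. -/
abbrev Sections : Type _ := ∀ γ : G, 𝒪.Stalk (𝒢.r γ)

variable {𝒪}

/-- `f` is supported on the compact open bisection `U`: it is continuous on `U` and vanishes off
`U`. -/
def IsSupportedOn (f : 𝒪.Sections) (U : Set G) : Prop :=
  𝒢.IsCompactOpenBisection U ∧ ContinuousOn (fun γ => (f γ : E)) U ∧ ∀ γ ∉ U, f γ = 0

variable (𝒪)

/-- `Γ_c(𝒢, 𝒪)`: the additive subgroup generated by the sections that are supported on a compact
open bisection. -/
def Gammac : AddSubgroup 𝒪.Sections :=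
  AddSubgroup.closure {f | ∃ U : Set G, IsSupportedOn f U}

variable {𝒪}

/-- The summand `f(β) α_β(g(ρ))`, for `d(β) = r(ρ)`. -/
def convTerm (f g : 𝒪.Sections) (β ρ : G) (h : 𝒢.d β = 𝒢.r ρ) : 𝒪.Stalk (𝒢.r β) :=
  f β * 𝒪.actHom β (𝒪.castHom h.symm (g ρ))

/-- The convolution `(f * g)(γ) = ∑_{βρ = γ} f(β) α_β(g(ρ))`; the sum has finitely many nonzero
summands when `f` is in `Γ_c(𝒢, 𝒪)`. -/
noncomputable def conv (f g : 𝒪.Sections) : 𝒪.Sections := fun γ =>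
  ∑ᶠ q : {q : G × G // 𝒢.d q.1 = 𝒢.r q.2 ∧ 𝒢.mul q.1 q.2 = γ},
    𝒪.castHom (𝒢.r_factor q.2.1 q.2.2) (convTerm f g q.1.1 q.1.2 q.2.1)

theorem castHom_castHom {x y z : X} (h : x = y) (h' : y = z) (a : 𝒪.Stalk x) :
    𝒪.castHom h' (𝒪.castHom h a) = 𝒪.castHom (h.trans h') a := rfl

theorem castHom_apply (f : 𝒪.Sections) {β γ : G} (h : β = γ) (h' : 𝒢.r β = 𝒢.r γ) :
    𝒪.castHom h' (f β) = f γ := by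
  subst h; rfl

/-- Factorizations of `γ` are determined by the first factor. -/
theorem factor_ext {γ : G} {q q' : {q : G × G // 𝒢.d q.1 = 𝒢.r q.2 ∧ 𝒢.mul q.1 q.2 = γ}}
    (h : q.1.1 = q'.1.1) : q = q' := by
  obtain ⟨⟨β, ρ⟩, h1, rfl⟩ := q
  obtain ⟨⟨β', ρ'⟩, h1', h2'⟩ := q'
  dsimp only at *
  subst h
  have := EtaleGroupoid.inv_mul_cancel h1
  rw [← h2', EtaleGroupoid.inv_mul_cancel h1'] at this
  subst this
  rfl

theorem finite_fiber {f : 𝒪.Sections} (hf : f ∈ 𝒪.Gammac) (x : X) :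
    {β | 𝒢.r β = x ∧ f β ≠ 0}.Finite := by
  induction hf using AddSubgroup.closure_induction with
  | mem f hf =>
    obtain ⟨U, hU, -, h0⟩ := hf
    refine Set.Subsingleton.finite ?_
    rintro β ⟨rfl, hβ⟩ γ ⟨h, hγ⟩
    exact hU.2.2.2 (not_imp_comm.1 (h0 β) hβ) (not_imp_comm.1 (h0 γ) hγ) h.symm
  | zero => simp
  | add f g _ _ hf hg =>
    refine (hf.union hg).subset ?_
    rintro β ⟨rfl, hβ⟩
    by_contra hc
    simp only [mem_union, mem_ofPred_eq, true_and, not_or, not_not] at hc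
    exact hβ (by rw [Pi.add_apply, hc.1, hc.2, add_zero])
  | neg f _ hf =>
    refine hf.subset ?_
    rintro β ⟨rfl, hβ⟩
    exact ⟨rfl, fun h => hβ (by rw [Pi.neg_apply, h, neg_zero])⟩

theorem conv_support_finite {f : 𝒪.Sections} (hf : f ∈ 𝒪.Gammac) (g : 𝒪.Sections) (γ : G) :
    (Function.support fun q : {q : G × G // 𝒢.d q.1 = 𝒢.r q.2 ∧ 𝒢.mul q.1 q.2 = γ} =>
      𝒪.castHom (𝒢.r_factor q.2.1 q.2.2) (convTerm f g q.1.1 q.1.2 q.2.1)).Finite := by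
  refine Set.Finite.of_finite_image (f := fun q => q.1.1) ((finite_fiber hf (𝒢.r γ)).subset ?_)
    fun q _ q' _ h => factor_ext h
  rintro _ ⟨q, hq, rfl⟩
  refine ⟨𝒢.r_factor q.2.1 q.2.2, fun h => hq ?_⟩
  simp only [convTerm, h, zero_mul, map_zero]

theorem add_conv {f f' : 𝒪.Sections} (hf : f ∈ 𝒪.Gammac) (hf' : f' ∈ 𝒪.Gammac)
    (g : 𝒪.Sections) : conv (f + f') g = conv f g + conv f' g := by
  funext γ
  rw [Pi.add_apply, conv, conv, conv,
    ← finsum_add_distrib (conv_support_finite hf g γ) (conv_support_finite hf' g γ)]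
  simp only [convTerm, Pi.add_apply, add_mul, map_add]

theorem conv_add {f : 𝒪.Sections} (hf : f ∈ 𝒪.Gammac)
    (g g' : 𝒪.Sections) : conv f (g + g') = conv f g + conv f g' := by
  funext γ
  rw [Pi.add_apply, conv, conv, conv,
    ← finsum_add_distrib (conv_support_finite hf g γ) (conv_support_finite hf g' γ)]
  simp only [convTerm, Pi.add_apply, mul_add, map_add]

theorem neg_conv (f g : 𝒪.Sections) : conv (-f) g = -conv f g := by
  funext γ
  rw [Pi.neg_apply, conv, conv, ← finsum_neg_distrib]
  simp only [convTerm, Pi.neg_apply, neg_mul, map_neg]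

theorem conv_neg (f g : 𝒪.Sections) : conv f (-g) = -conv f g := by
  funext γ
  rw [Pi.neg_apply, conv, conv, ← finsum_neg_distrib]
  simp only [convTerm, Pi.neg_apply, mul_neg, map_neg]

theorem zero_conv (g : 𝒪.Sections) : conv 0 g = 0 := by
  funext γ
  simp only [conv, convTerm, Pi.zero_apply, zero_mul, map_zero, finsum_zero]

theorem conv_zero (f : 𝒪.Sections) : conv f 0 = 0 := by
  funext γ
  simp only [conv, convTerm, Pi.zero_apply, mul_zero, map_zero, finsum_zero]

theorem conv_apply_mul {f : 𝒪.Sections} {U : Set G} (hf : IsSupportedOn f U) (g : 𝒪.Sections)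
    {β ρ : G} (hβ : β ∈ U) (h : 𝒢.d β = 𝒢.r ρ) :
    conv f g (𝒢.mul β ρ) = 𝒪.castHom (𝒢.r_mul β ρ h).symm (convTerm f g β ρ h) := by
  rw [conv, finsum_eq_single _ ⟨(β, ρ), h, rfl⟩]
  intro q hq
  have : f q.1.1 = 0 := by
    refine hf.2.2 _ fun hqU => hq (factor_ext (hf.1.2.2.2 hqU hβ ?_))
    rw [← 𝒢.r_mul _ _ q.2.1, q.2.2, 𝒢.r_mul _ _ h]
  simp only [convTerm, this, zero_mul, map_zero]

theorem conv_apply_of_notMem {f g : 𝒪.Sections} {U V : Set G} (hf : IsSupportedOn f U)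
    (hg : IsSupportedOn g V) {γ : G} (hγ : γ ∉ 𝒢.setMul U V) : conv f g γ = 0 := by
  refine finsum_eq_zero_of_forall_eq_zero fun q => ?_
  by_cases h : q.1.1 ∈ U
  · have : g q.1.2 = 0 := hg.2.2 _ fun h' => hγ ⟨_, h, _, h', q.2.1, q.2.2⟩
    simp only [convTerm, this, mul_zero, map_zero]
  · simp only [convTerm, hf.2.2 _ h, zero_mul, map_zero]

theorem IsSupportedOn.conv [T2Space X] {f g : 𝒪.Sections} {U V : Set G} (hf : IsSupportedOn f U)
    (hg : IsSupportedOn g V) : IsSupportedOn (conv f g) (𝒢.setMul U V) := by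
  refine ⟨hf.1.setMul hg.1, ?_, fun γ => conv_apply_of_notMem hf hg⟩
  obtain ⟨b, c, hb, hc, hUV, hbc⟩ := EtaleGroupoid.exists_factor (𝒢 := 𝒢) (V := V) hf.1.2.1
    hf.1.2.2.2
  have hsub : 𝒢.setMul U V ⊆ 𝒢.r ⁻¹' (𝒢.r '' U) := hUV ▸ inter_subset_left
  have hbU : MapsTo b (𝒢.setMul U V) U := by
    rintro _ ⟨β, hβ, ρ, hρ, h, rfl⟩
    rwa [(hbc β hβ ρ h).1]
  have hcV : MapsTo c (𝒢.setMul U V) V := by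
    rintro _ ⟨β, hβ, ρ, hρ, h, rfl⟩
    rwa [(hbc β hβ ρ h).2]
  have hdr : ∀ γ ∈ 𝒢.setMul U V, 𝒢.d (b γ) = 𝒢.r (c γ) := by
    rintro _ ⟨β, hβ, ρ, hρ, h, rfl⟩
    rwa [(hbc β hβ ρ h).1, (hbc β hβ ρ h).2]
  have h1 : ContinuousOn (fun γ => (f (b γ) : E)) (𝒢.setMul U V) :=
    hf.2.1.comp (hb.mono hsub) hbU
  have h2 : ContinuousOn (fun γ => (g (c γ) : E)) (𝒢.setMul U V) :=
    hg.2.1.comp (hc.mono hsub) hcV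
  have h3 : ContinuousOn (fun γ => 𝒪.act (b γ) (g (c γ) : E)) (𝒢.setMul U V) :=
    𝒪.continuousOn_act.comp ((hb.mono hsub).prodMk h2) fun γ hγ => by
      change 𝒢.d (b γ) = 𝒪.p (g (c γ))
      rw [(g (c γ)).2, hdr γ hγ]
  rw [continuousOn_iff_continuous_domRestrict] at h1 h3 ⊢
  have hp : ∀ γ : 𝒢.setMul U V, 𝒪.p (f (b γ) : E) = 𝒪.p (𝒪.act (b γ) (g (c γ) : E)) := by
    intro γ
    rw [𝒪.p_act _ _ (by rw [(g (c γ)).2, hdr γ γ.2]), (f (b γ)).2]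
  have h4 := 𝒪.continuous_mul.comp ((h1.prodMk h3).subtype_mk hp)
  refine h4.congr ?_
  rintro ⟨_, β, hβ, ρ, hρ, h, rfl⟩
  simp only [Function.comp_apply, domRestrict_apply]
  rw [conv_apply_mul hf g hβ h]
  obtain ⟨e1, e2⟩ := hbc β hβ ρ h
  have key : ∀ (x y : X) (_ : x = y) (a a' b b' : E) (ha : 𝒪.p a = x) (hb : 𝒪.p b = x)
      (ha' : 𝒪.p a' = y) (hb' : 𝒪.p b' = y), a = a' → b = b' →
      (((⟨a, ha⟩ : 𝒪.Stalk x) * ⟨b, hb⟩ : 𝒪.Stalk x) : E) =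
        (((⟨a', ha'⟩ : 𝒪.Stalk y) * ⟨b', hb'⟩ : 𝒪.Stalk y) : E) := by
    rintro x _ rfl a _ b _ ha hb ha' hb' rfl rfl
    rfl
  refine key _ (𝒢.r β) ?_ _ (f β) _ (𝒪.act β (g ρ)) _ _ (f β).2
    (𝒪.p_act _ _ (by rw [(g ρ).2, h])) (by rw [e1]) (by rw [e1, e2])
  change 𝒪.p (𝒪.act (b (𝒢.mul β ρ)) (g (c (𝒢.mul β ρ)) : E)) = 𝒢.r β
  rw [e1, e2, 𝒪.p_act _ _ (by rw [(g ρ).2, h])]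

theorem conv_mem [T2Space X] {f g : 𝒪.Sections} (hf : f ∈ 𝒪.Gammac) (hg : g ∈ 𝒪.Gammac) :
    conv f g ∈ 𝒪.Gammac := by
  induction hf using AddSubgroup.closure_induction with
  | mem f hf =>
    have hf' : f ∈ 𝒪.Gammac := AddSubgroup.subset_closure hf
    induction hg using AddSubgroup.closure_induction with
    | mem g hg =>
      obtain ⟨U, hf⟩ := hf
      obtain ⟨V, hg⟩ := hg
      exact AddSubgroup.subset_closure ⟨_, hf.conv hg⟩
    | zero => rw [conv_zero]; exact zero_mem _
    | add g g' _ _ h h' => rw [conv_add hf']; exact add_mem h h'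
    | neg g _ h => rw [conv_neg]; exact neg_mem h
  | zero => rw [zero_conv]; exact zero_mem _
  | add f f' hf hf' h h' => rw [add_conv hf hf']; exact add_mem h h'
  | neg f _ h => rw [neg_conv]; exact neg_mem h

theorem actHom_mul {β γ : G} (h : 𝒢.d β = 𝒢.r γ) (a : 𝒪.Stalk (𝒢.d γ)) :
    𝒪.actHom β (𝒪.castHom h.symm (𝒪.actHom γ a)) = 𝒪.castHom (𝒢.r_mul β γ h)
      (𝒪.actHom (𝒢.mul β γ) (𝒪.castHom (𝒢.d_mul β γ h).symm a)) :=
  Subtype.ext (𝒪.act_act β γ a.1 h a.2.symm)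

theorem conv_assoc_of_isSupportedOn [T2Space X] {f g h : 𝒪.Sections} {U V W : Set G}
    (hf : IsSupportedOn f U) (hg : IsSupportedOn g V) (hh : IsSupportedOn h W) :
    conv (conv f g) h = conv f (conv g h) := by
  funext γ
  by_cases hγ : γ ∈ 𝒢.setMul (𝒢.setMul U V) W
  · obtain ⟨_, ⟨β, hβ, ρ, hρ, h1, rfl⟩, τ, hτ, h2, rfl⟩ := hγ
    have h2' : 𝒢.d ρ = 𝒢.r τ := by rwa [𝒢.d_mul _ _ h1] at h2
    have h3 : 𝒢.d β = 𝒢.r (𝒢.mul ρ τ) := by rw [h1, 𝒢.r_mul _ _ h2']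
    rw [conv_apply_mul (hf.conv hg) h ⟨β, hβ, ρ, hρ, h1, rfl⟩ h2,
      ← castHom_apply (conv f (conv g h)) (𝒢.mul_assoc _ _ _ h1 h2').symm
        (by rw [𝒢.mul_assoc _ _ _ h1 h2']),
      conv_apply_mul hf _ hβ h3]
    simp only [convTerm]
    rw [conv_apply_mul hf g hβ h1, conv_apply_mul hg h hρ h2']
    simp only [convTerm, map_mul, castHom_castHom]
    rw [_root_.mul_assoc]
    refine congrArg₂ _ rfl (congrArg₂ _ rfl ?_)
    exact (congrArg (𝒪.castHom _) (actHom_mul h1 (𝒪.castHom h2'.symm (h τ)))).symm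
  · rw [conv_apply_of_notMem (hf.conv hg) hh hγ, conv_apply_of_notMem hf (hg.conv hh)]
    rintro ⟨β, hβ, _, ⟨ρ, hρ, τ, hτ, h1, rfl⟩, h2, rfl⟩
    rw [𝒢.r_mul _ _ h1] at h2
    exact hγ ⟨_, ⟨β, hβ, ρ, hρ, h2, rfl⟩, τ, hτ, by rw [𝒢.d_mul _ _ h2, h1],
      𝒢.mul_assoc _ _ _ h2 h1⟩

theorem conv_assoc [T2Space X] {f g h : 𝒪.Sections} (hf : f ∈ 𝒪.Gammac) (hg : g ∈ 𝒪.Gammac)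
    (hh : h ∈ 𝒪.Gammac) : conv (conv f g) h = conv f (conv g h) := by
  induction hf using AddSubgroup.closure_induction with
  | mem f hf =>
    have hf' : f ∈ 𝒪.Gammac := AddSubgroup.subset_closure hf
    induction hg using AddSubgroup.closure_induction with
    | mem g hg =>
      have hg' : g ∈ 𝒪.Gammac := AddSubgroup.subset_closure hg
      induction hh using AddSubgroup.closure_induction with
      | mem h hh =>
        obtain ⟨U, hf⟩ := hf
        obtain ⟨V, hg⟩ := hg
        obtain ⟨W, hh⟩ := hh
        exact conv_assoc_of_isSupportedOn hf hg hh
      | zero => simp only [conv_zero]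
      | add h h' _ _ e e' =>
        rw [conv_add (conv_mem hf' hg'), conv_add hg', conv_add hf', e, e']
      | neg h _ e => simp only [conv_neg, e]
    | zero => simp only [conv_zero, zero_conv]
    | add g g' hg hg' e e' =>
      rw [conv_add hf', add_conv (conv_mem hf' hg) (conv_mem hf' hg'), add_conv hg hg',
        conv_add hf', e, e']
    | neg g _ e => simp only [conv_neg, neg_conv, e]
  | zero => simp only [zero_conv]
  | add f f' hf hf' e e' =>
    rw [add_conv hf hf', add_conv (conv_mem hf hg) (conv_mem hf' hg), add_conv hf hf', e, e']
  | neg f _ e => simp only [neg_conv, e]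

noncomputable instance [T2Space X] : Mul 𝒪.Gammac := ⟨fun f g => ⟨conv f.1 g.1, conv_mem f.2 g.2⟩⟩

/-- The ring `Γ_c(𝒢, 𝒪)`, with pointwise addition and convolution. -/
noncomputable instance instNonUnitalRingGammac [T2Space X] : NonUnitalRing 𝒪.Gammac where
  left_distrib f g h := Subtype.ext (conv_add f.2 g.1 h.1)
  right_distrib f g h := Subtype.ext (add_conv f.2 g.2 h.1)
  zero_mul f := Subtype.ext (zero_conv f.1)
  mul_zero f := Subtype.ext (conv_zero f.1)
  mul_assoc f g h := Subtype.ext (conv_assoc f.2 g.2 h.2)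

end GroupoidSheafOfRings

/-! The statement is proved for any effective Hausdorff étale groupoid whose unit space is
Hausdorff, non-empty and has a basis of compact open sets; topological freeness of `θ` makes the
groupoid of germs effective (`isEffective_groupoid`), and the two notions of invariant open set
agree (`isMinimal_groupoid_iff`).

Simple implies minimal: an open invariant `U` gives the ideal of all `f` vanishing off `r⁻¹(U)`. A
point of `U` makes this ideal nonzero and a point outside `U` makes it proper, as characteristic
functions of compact open sets of units show (`isMinimal_of_isSimpleRing`).

Minimal implies simple: let `f` be in a nonzero ideal `I`, with `f(γ) ≠ 0`. Right multiplication by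
the characteristic function of the inverse of a bisection through `γ` gives `g ∈ I` that is nonzero
at the unit `r(γ)`. By effectiveness, the non-unit isotropy arrows in the support of `g` lie over a
nowhere dense set, while `g` is nonzero on an open set of units. A small compact open `V` inside
that open set therefore avoids all non-unit arrows of the support that both start and end in `V`
(`exists_corner`). The corner `1_V g 1_V` is then a nowhere zero section over `V`; since the stalks
are fields it has a continuous inverse, so `1_V ∈ I` (`exists_indic_mem`).

Conjugation by bisections makes the union of all compact open `W` with `1_W ∈ I` invariant, hence
equal to `X`. These `W` are closed under finite unions, so one of them contains the ranges of the
arrows supporting any given generator `f`, and `f = 1_W f ∈ I` (`eq_top_of_isMinimal`). -/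

namespace EtaleGroupoid

/-! ### Effectiveness, minimality and compact open bisections. -/

variable {X G : Type*} [TopologicalSpace X] [TopologicalSpace G] {𝒢 : EtaleGroupoid X G}

/-- An étale groupoid is effective if every open set of isotropy arrows consists of units. -/
def IsEffective (𝒢 : EtaleGroupoid X G) : Prop :=
  ∀ W : Set G, IsOpen W → (∀ γ ∈ W, 𝒢.d γ = 𝒢.r γ) → W ⊆ range 𝒢.unit

/-- An étale groupoid is minimal if its unit space has no open invariant subsets but the trivial
ones. -/
def IsMinimal (𝒢 : EtaleGroupoid X G) : Prop :=
  ∀ U : Set X, IsOpen U → (∀ γ, 𝒢.d γ ∈ U → 𝒢.r γ ∈ U) → U = ∅ ∨ U = univ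

/-- A continuous section of the local homeomorphism `d` is itself a local homeomorphism. -/
theorem isOpenMap_unit : IsOpenMap 𝒢.unit := by
  have h : 𝒢.d ∘ 𝒢.unit = id := funext 𝒢.d_unit
  have h' : IsLocalHomeomorph (𝒢.d ∘ 𝒢.unit) := h ▸ (Homeomorph.refl X).isLocalHomeomorph
  exact (h'.of_comp 𝒢.isLocalHomeomorph_d 𝒢.continuous_unit).isOpenMap

theorem isCompactOpenBisection_image_unit {V : Set X} (hc : IsCompact V) (ho : IsOpen V) :
    𝒢.IsCompactOpenBisection (𝒢.unit '' V) := by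
  refine ⟨hc.image 𝒢.continuous_unit, isOpenMap_unit _ ho, ?_, ?_⟩
  · rintro _ ⟨x, -, rfl⟩ _ ⟨y, -, rfl⟩ h
    rw [𝒢.d_unit, 𝒢.d_unit] at h
    rw [h]
  · rintro _ ⟨x, -, rfl⟩ _ ⟨y, -, rfl⟩ h
    rw [𝒢.r_unit, 𝒢.r_unit] at h
    rw [h]

theorem mem_image_unit {V : Set X} {γ : G} :
    γ ∈ 𝒢.unit '' V ↔ 𝒢.r γ ∈ V ∧ 𝒢.unit (𝒢.r γ) = γ := by
  constructor
  · rintro ⟨x, hx, rfl⟩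
    rw [𝒢.r_unit]
    exact ⟨hx, rfl⟩
  · rintro ⟨h, h'⟩
    exact ⟨_, h, h'⟩

theorem inv_inv (γ : G) : 𝒢.inv (𝒢.inv γ) = γ := by
  have h := inv_mul_cancel (𝒢.d_inv γ)
  rw [𝒢.inv_mul, ← 𝒢.r_inv, ← 𝒢.d_inv, 𝒢.mul_unit] at h
  exact h

theorem IsCompactOpenBisection.inv {B : Set G} (hB : 𝒢.IsCompactOpenBisection B) :
    𝒢.IsCompactOpenBisection (𝒢.inv '' B) := by
  obtain ⟨hc, ho, hd, hr⟩ := hB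
  refine ⟨hc.image 𝒢.continuous_inv, ?_, ?_, ?_⟩
  · rw [image_eq_preimage_of_inverse inv_inv inv_inv]
    exact ho.preimage 𝒢.continuous_inv
  · rintro _ ⟨β, hβ, rfl⟩ _ ⟨γ, hγ, rfl⟩ h
    rw [𝒢.d_inv, 𝒢.d_inv] at h
    rw [hr hβ hγ h]
  · rintro _ ⟨β, hβ, rfl⟩ _ ⟨γ, hγ, rfl⟩ h
    rw [𝒢.r_inv, 𝒢.r_inv] at h
    rw [hd hβ hγ h]

/-- For a bisection `B`, we have `B B⁻¹ = r(B)`. -/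
theorem setMul_image_inv {B : Set G} (hd : InjOn 𝒢.d B) :
    𝒢.setMul B (𝒢.inv '' B) = 𝒢.unit '' (𝒢.r '' B) := by
  ext γ
  constructor
  · rintro ⟨β, hβ, _, ⟨ρ, hρ, rfl⟩, h, rfl⟩
    rw [𝒢.r_inv] at h
    obtain rfl := hd hβ hρ h
    exact ⟨_, ⟨β, hβ, rfl⟩, (𝒢.mul_inv β).symm⟩
  · rintro ⟨_, ⟨β, hβ, rfl⟩, rfl⟩
    exact ⟨β, hβ, _, ⟨β, hβ, rfl⟩, (𝒢.r_inv β).symm, 𝒢.mul_inv β⟩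

/-- Arrows near `γ` on which `d` and `r` are both injective form an open set; it is cut down to the
part over a compact open neighbourhood of `d(γ)`. The control by `O` is needed to carry a set of
units along a bisection whose sources all lie in it. -/
theorem exists_isCompactOpenBisection
    (hX : TopologicalSpace.IsTopologicalBasis {C : Set X | IsCompact C ∧ IsOpen C}) (γ : G)
    {O : Set X} (hO : IsOpen O) (hγ : 𝒢.d γ ∈ O) :
    ∃ B, 𝒢.IsCompactOpenBisection B ∧ γ ∈ B ∧ MapsTo 𝒢.d B O := by
  obtain ⟨e, he, hde⟩ := 𝒢.isLocalHomeomorph_d γ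
  obtain ⟨e', he', hre⟩ := 𝒢.isLocalHomeomorph_r γ
  have hW := e.open_source.inter e'.open_source
  have hdW := 𝒢.isLocalHomeomorph_d.isOpenMap _ hW
  obtain ⟨C, ⟨hCc, hCo⟩, hγC, hC⟩ := hX.exists_subset_of_mem_open
    (show 𝒢.d γ ∈ 𝒢.d '' (e.source ∩ e'.source) ∩ O from ⟨⟨γ, ⟨he, he'⟩, rfl⟩, hγ⟩)
    (hdW.inter hO)
  have hdi : InjOn 𝒢.d (e.source ∩ e'.source) := by
    rw [hde]; exact e.injOn.mono inter_subset_left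
  refine ⟨e.source ∩ e'.source ∩ 𝒢.d ⁻¹' C, ⟨?_, hW.inter
    (hCo.preimage 𝒢.isLocalHomeomorph_d.continuous), hdi.mono inter_subset_left, ?_⟩,
    ⟨⟨he, he'⟩, hγC⟩, fun β hβ => (hC hβ.2).2⟩
  -- Compactness: the set is the image of `C` under the local inverse of `d`.
  · have hCt : C ⊆ e.target := by
      intro x hx
      obtain ⟨⟨β, hβ, rfl⟩, -⟩ := hC hx
      rw [hde]
      exact e.map_source hβ.1
    convert hCc.image_of_continuousOn (e.continuousOn_symm.mono hCt) using 1
    ext β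
    constructor
    · rintro ⟨⟨hβ, -⟩, hβC⟩
      exact ⟨_, hβC, by rw [hde, e.left_inv hβ]⟩
    · rintro ⟨x, hx, rfl⟩
      obtain ⟨⟨β, hβ, rfl⟩, -⟩ := hC hx
      have : e.symm (𝒢.d β) = β := by rw [hde, e.left_inv hβ.1]
      rw [this]
      exact ⟨hβ, hx⟩
  · rw [hre]
    exact e'.injOn.mono (inter_subset_left.trans inter_subset_right)

end EtaleGroupoid

/-! ### Local sections of a sheaf of rings or fields. -/

namespace GroupoidSheafOfRings

variable {X G : Type*} [TopologicalSpace X] [TopologicalSpace G] {𝒢 : EtaleGroupoid X G}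
  {E : Type*} [TopologicalSpace E] {𝒪 : GroupoidSheafOfRings 𝒢 E}

/-- Near `x` both sections stay in one sheet of `p` around their common value, and `p` is injective
there. -/
theorem eventually_eq_of_apply_eq {a b : ∀ x, 𝒪.Stalk x} {x : X}
    (ha : ContinuousAt (fun y => (a y : E)) x) (hb : ContinuousAt (fun y => (b y : E)) x)
    (h : a x = b x) : ∀ᶠ y in 𝓝 x, a y = b y := by
  obtain ⟨e, he, hpe⟩ := 𝒪.isLocalHomeomorph_p (a x)
  have hs := e.open_source.mem_nhds he
  have hs' := hs
  rw [h] at hs'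
  filter_upwards [ha hs, hb hs'] with y h1 h2
  refine Subtype.ext (e.injOn h1 h2 ?_)
  rw [← hpe, (a y).2, (b y).2]

-- The inverse of `p` on a sheet through `s` is the required section; its values off that sheet are
-- irrelevant.
variable (𝒪) in
theorem exists_continuousAt (x : X) (s : 𝒪.Stalk x) :
    ∃ a : ∀ y, 𝒪.Stalk y, ContinuousAt (fun y => (a y : E)) x ∧ a x = s := by
  classical
  obtain ⟨e, he, hpe⟩ := 𝒪.isLocalHomeomorph_p s
  have hx : x = e s := by rw [← hpe, s.2]
  have hxt : x ∈ e.target := hx ▸ e.map_source he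
  have hsec : ∀ y ∈ e.target, 𝒪.p (e.symm y) = y := fun y hy => by rw [hpe, e.right_inv hy]
  refine ⟨fun y => if h : 𝒪.p (e.symm y) = y then ⟨e.symm y, h⟩ else 0, ?_, ?_⟩
  · refine (e.continuousAt_symm hxt).congr ?_
    filter_upwards [e.open_target.mem_nhds hxt] with y hy
    rw [dif_pos (hsec y hy)]
  · refine (dif_pos (hsec x hxt)).trans (Subtype.ext ?_)
    change e.symm x = s
    conv_lhs => rw [hx]
    exact e.left_inv he

/-- Continuity of addition is formulated in the stalk over `p` of the second summand, whereas
sections are added over `y`; this passes between the two. -/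
theorem coe_add_eq {x y : X} (h : x = y) {u v : E} (hu : 𝒪.p u = x) (hv : 𝒪.p v = x)
    (hu' : 𝒪.p u = y) (hv' : 𝒪.p v = y) :
    (((⟨u, hu⟩ : 𝒪.Stalk x) + ⟨v, hv⟩ : 𝒪.Stalk x) : E) =
      ((⟨u, hu'⟩ : 𝒪.Stalk y) + ⟨v, hv'⟩ : 𝒪.Stalk y) := by
  subst h; rfl

theorem coe_mul_eq {x y : X} (h : x = y) {u v : E} (hu : 𝒪.p u = x) (hv : 𝒪.p v = x)
    (hu' : 𝒪.p u = y) (hv' : 𝒪.p v = y) :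
    (((⟨u, hu⟩ : 𝒪.Stalk x) * ⟨v, hv⟩ : 𝒪.Stalk x) : E) =
      ((⟨u, hu'⟩ : 𝒪.Stalk y) * ⟨v, hv'⟩ : 𝒪.Stalk y) := by
  subst h; rfl

section Continuity

variable {a b : ∀ x, 𝒪.Stalk x} {x : X}

theorem continuousAt_add (ha : ContinuousAt (fun y => (a y : E)) x)
    (hb : ContinuousAt (fun y => (b y : E)) x) :
    ContinuousAt (fun y => ((a y + b y : 𝒪.Stalk y) : E)) x := by
  have hp : ∀ y, 𝒪.p (a y, b y).1 = 𝒪.p (a y, b y).2 := fun y => by rw [(a y).2, (b y).2]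
  have h : ContinuousAt (fun y => (⟨(a y, b y), hp y⟩ : {q : E × E // 𝒪.p q.1 = 𝒪.p q.2})) x :=
    (continuousAt_codRestrict_iff hp).2 (ha.prodMk hb)
  refine (𝒪.continuous_add.continuousAt.comp h).congr (.of_forall fun y => ?_)
  exact coe_add_eq (b y).2 _ _ _ _

theorem continuousAt_mul (ha : ContinuousAt (fun y => (a y : E)) x)
    (hb : ContinuousAt (fun y => (b y : E)) x) :
    ContinuousAt (fun y => ((a y * b y : 𝒪.Stalk y) : E)) x := by
  have hp : ∀ y, 𝒪.p (a y, b y).1 = 𝒪.p (a y, b y).2 := fun y => by rw [(a y).2, (b y).2]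
  have h : ContinuousAt (fun y => (⟨(a y, b y), hp y⟩ : {q : E × E // 𝒪.p q.1 = 𝒪.p q.2})) x :=
    (continuousAt_codRestrict_iff hp).2 (ha.prodMk hb)
  refine (𝒪.continuous_mul.continuousAt.comp h).congr (.of_forall fun y => ?_)
  exact coe_mul_eq (b y).2 _ _ _ _

-- Only addition, multiplication and `1` are assumed continuous. A section `a` through `0` satisfies
-- `a + a = a` at `x`, hence near `x`, so it is zero there.
variable (𝒪) in
theorem continuousAt_zero (x : X) : ContinuousAt (fun y => ((0 : 𝒪.Stalk y) : E)) x := by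
  obtain ⟨a, ha, h0⟩ := 𝒪.exists_continuousAt x 0
  have h := eventually_eq_of_apply_eq (a := fun y => a y + a y) (continuousAt_add ha ha) ha
    (by rw [h0, add_zero])
  refine ha.congr (h.mono fun y hy => ?_)
  dsimp only
  rw [add_eq_left.1 hy]

/-- A continuous section through `-a(x)` sums with `a` to `0` at `x`, hence near `x`, so it is `-a`
there. -/
theorem continuousAt_neg (ha : ContinuousAt (fun y => (a y : E)) x) :
    ContinuousAt (fun y => ((-a y : 𝒪.Stalk y) : E)) x := by
  obtain ⟨b, hb, h0⟩ := 𝒪.exists_continuousAt x (-a x)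
  have h := eventually_eq_of_apply_eq (a := fun y => a y + b y) (b := fun y => 0)
    (continuousAt_add ha hb) (𝒪.continuousAt_zero x) (by rw [h0, add_neg_cancel])
  refine hb.congr (h.mono fun y hy => ?_)
  dsimp only
  rw [neg_eq_of_add_eq_zero_right hy]

/-- Inverses in the stalks, with `0⁻¹ = 0`. -/
noncomputable def stalkInv (h𝒪 : 𝒪.IsSheafOfFields) (x : X) (s : 𝒪.Stalk x) : 𝒪.Stalk x :=
  open Classical in if h : s = 0 then 0 else ((h𝒪 x).mul_inv_cancel h).choose

theorem mul_stalkInv (h𝒪 : 𝒪.IsSheafOfFields) {s : 𝒪.Stalk x} (hs : s ≠ 0) :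
    s * stalkInv h𝒪 x s = 1 := by
  rw [stalkInv, dif_neg hs]
  exact ((h𝒪 x).mul_inv_cancel hs).choose_spec

theorem one_ne_zero (h𝒪 : 𝒪.IsSheafOfFields) (x : X) : (1 : 𝒪.Stalk x) ≠ 0 := fun h => by
  obtain ⟨u, v, huv⟩ := (h𝒪 x).exists_pair_ne
  exact huv (by rw [← one_mul u, ← one_mul v, h, zero_mul, zero_mul])

/-- A section of a sheaf of fields that is nonzero at a point is nonzero nearby, with a continuous
inverse. -/
theorem eventually_ne_zero_and_continuousAt_stalkInv (h𝒪 : 𝒪.IsSheafOfFields)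
    (ha : ContinuousAt (fun y => (a y : E)) x) (hx : a x ≠ 0) :
    (∀ᶠ y in 𝓝 x, a y ≠ 0) ∧ ContinuousAt (fun y => (stalkInv h𝒪 y (a y) : E)) x := by
  -- A local section `b` through the inverse of `a(x)` satisfies `ab = 1` at `x`, hence near `x`; so
  -- `a` has no zeros there and `b` is its inverse.
  obtain ⟨b, hb, h0⟩ := 𝒪.exists_continuousAt x (stalkInv h𝒪 x (a x))
  have h := eventually_eq_of_apply_eq (a := fun y => a y * b y) (b := fun y => 1)
    (continuousAt_mul ha hb) 𝒪.continuous_one.continuousAt (by rw [h0, mul_stalkInv h𝒪 hx])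
  have hne : ∀ᶠ y in 𝓝 x, a y ≠ 0 := h.mono fun y hy h0 => by
    rw [h0, zero_mul] at hy
    exact one_ne_zero h𝒪 y hy.symm
  refine ⟨hne, hb.congr ?_⟩
  filter_upwards [h, hne] with y hy hy'
  have := mul_stalkInv h𝒪 hy'
  congr 1
  calc b y = b y * (a y * stalkInv h𝒪 y (a y)) := by rw [this, mul_one]
    _ = (a y * b y) * stalkInv h𝒪 y (a y) := by rw [← mul_assoc, (h𝒪 y).mul_comm (a y)]
    _ = _ := by rw [hy, one_mul]

end Continuity

/-! ### Characteristic functions and their convolutions. -/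

/-- The map with value `a(r(γ))` at `γ ∈ B`, and `0` off `B`. -/
noncomputable def pullback (a : ∀ x, 𝒪.Stalk x) (B : Set G) : 𝒪.Sections := fun γ =>
  open Classical in if γ ∈ B then a (𝒢.r γ) else 0

theorem isSupportedOn_pullback {a : ∀ x, 𝒪.Stalk x} {B : Set G} (hB : 𝒢.IsCompactOpenBisection B)
    (ha : ∀ x ∈ 𝒢.r '' B, ContinuousAt (fun y => (a y : E)) x) :
    IsSupportedOn (pullback a B) B := by
  refine ⟨hB, ?_, fun γ hγ => if_neg hγ⟩
  have h : ContinuousOn (fun γ => (a (𝒢.r γ) : E)) B := fun γ hγ =>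
    (ContinuousAt.comp (f := 𝒢.r) (ha _ ⟨γ, hγ, rfl⟩)
      𝒢.isLocalHomeomorph_r.continuous.continuousAt).continuousWithinAt
  refine h.congr fun γ hγ => ?_
  rw [pullback, if_pos hγ]

variable (𝒪) in
/-- The characteristic function of `B`. -/
noncomputable def indic (B : Set G) : 𝒪.Sections := pullback (fun _ => 1) B

theorem indic_of_mem {B : Set G} {γ : G} (h : γ ∈ B) : 𝒪.indic B γ = 1 := if_pos h

theorem indic_of_notMem {B : Set G} {γ : G} (h : γ ∉ B) : 𝒪.indic B γ = 0 := if_neg h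

variable (𝒪) in
theorem isSupportedOn_indic {B : Set G} (hB : 𝒢.IsCompactOpenBisection B) :
    IsSupportedOn (𝒪.indic B) B :=
  isSupportedOn_pullback hB fun _ _ => 𝒪.continuous_one.continuousAt

theorem IsSupportedOn.mem_Gammac {f : 𝒪.Sections} {B : Set G} (h : IsSupportedOn f B) :
    f ∈ 𝒪.Gammac :=
  AddSubgroup.subset_closure ⟨B, h⟩

/-- Pointwise multiplication by a section on the unit space is a convolution. -/
theorem conv_pullback_unit {a : ∀ x, 𝒪.Stalk x} {V : Set X} (hc : IsCompact V) (ho : IsOpen V)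
    (ha : ∀ x ∈ V, ContinuousAt (fun y => (a y : E)) x) (f : 𝒪.Sections) {γ : G}
    (hγ : 𝒢.r γ ∈ V) : conv (pullback a (𝒢.unit '' V)) f γ = a (𝒢.r γ) * f γ := by
  have hB := EtaleGroupoid.isCompactOpenBisection_image_unit (𝒢 := 𝒢) hc ho
  have hs : IsSupportedOn (pullback a (𝒢.unit '' V)) (𝒢.unit '' V) := by
    refine isSupportedOn_pullback hB ?_
    rintro _ ⟨_, ⟨x, hx, rfl⟩, rfl⟩
    rw [𝒢.r_unit]
    exact ha x hx
  have hm : 𝒢.unit (𝒢.r γ) ∈ 𝒢.unit '' V := ⟨_, hγ, rfl⟩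
  -- With `γ` written as `unit (r γ) · γ`, the convolution has a single summand; `castHom` absorbs
  -- the change of stalk.
  rw [← castHom_apply (conv _ f) (𝒢.unit_mul γ) (by rw [𝒢.unit_mul]),
    conv_apply_mul hs f hm (𝒢.d_unit _), convTerm, map_mul, map_mul]
  congr 1
  · rw [pullback, if_pos hm]
    have : ∀ (x y : X) (h : x = y), 𝒪.castHom h (a x) = a y := by rintro x _ rfl; rfl
    rw [castHom_castHom, this]
  · refine Subtype.ext ?_
    have := 𝒪.act_unit (f γ)
    rwa [(f γ).2] at this

theorem conv_indic_unit {V : Set X} (hc : IsCompact V) (ho : IsOpen V) (f : 𝒪.Sections) {γ : G}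
    (hγ : 𝒢.r γ ∈ V) : conv (𝒪.indic (𝒢.unit '' V)) f γ = f γ := by
  rw [indic, conv_pullback_unit hc ho (fun _ _ => 𝒪.continuous_one.continuousAt) f hγ, one_mul]

theorem conv_apply_eq_zero_left {f g : 𝒪.Sections} {γ : G}
    (h : ∀ β, 𝒢.r β = 𝒢.r γ → f β = 0) : conv f g γ = 0 := by
  refine finsum_eq_zero_of_forall_eq_zero fun q => ?_
  simp only [convTerm, h _ (𝒢.r_factor q.2.1 q.2.2), zero_mul, map_zero]

theorem conv_apply_eq_zero_right {f g : 𝒪.Sections} {γ : G}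
    (h : ∀ ρ, 𝒢.d ρ = 𝒢.d γ → g ρ = 0) : conv f g γ = 0 := by
  refine finsum_eq_zero_of_forall_eq_zero fun q => ?_
  have : g q.1.2 = 0 := h _ ((𝒢.d_mul _ _ q.2.1).symm.trans (congrArg 𝒢.d q.2.2))
  simp only [convTerm, this, mul_zero, map_zero]

theorem conv_indic_unit_of_notMem {V : Set X} (f : 𝒪.Sections) {γ : G} (hγ : 𝒢.r γ ∉ V) :
    conv (𝒪.indic (𝒢.unit '' V)) f γ = 0 :=
  conv_apply_eq_zero_left fun _ hβ => indic_of_notMem fun h =>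
    hγ (hβ ▸ (EtaleGroupoid.mem_image_unit.1 h).1)

/-- Factorizations of `γ` are determined by the second factor. -/
theorem factor_ext_right {γ : G}
    {q q' : {q : G × G // 𝒢.d q.1 = 𝒢.r q.2 ∧ 𝒢.mul q.1 q.2 = γ}} (h : q.1.2 = q'.1.2) :
    q = q' := by
  obtain ⟨⟨β, ρ⟩, h1, rfl⟩ := q
  obtain ⟨⟨β', ρ'⟩, h1', h2'⟩ := q'
  dsimp only at *
  subst h
  -- The first factor is recovered as `(τρ)ρ⁻¹`.
  have key : ∀ τ, 𝒢.d τ = 𝒢.r ρ → 𝒢.mul (𝒢.mul τ ρ) (𝒢.inv ρ) = τ := fun τ h => by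
    rw [𝒢.mul_assoc _ _ _ h (𝒢.r_inv ρ).symm, 𝒢.mul_inv, ← h, 𝒢.mul_unit]
  have := key β' h1'
  rw [h2', key β h1] at this
  subst this
  rfl

/-- Since `d` is injective on `C`, the factorization with second factor in `C` is unique. No
condition on `f` is needed. -/
theorem conv_indic_apply_mul (f : 𝒪.Sections) {C : Set G} (hC : InjOn 𝒢.d C) {β ρ : G}
    (hρ : ρ ∈ C) (h : 𝒢.d β = 𝒢.r ρ) :
    conv f (𝒪.indic C) (𝒢.mul β ρ) = 𝒪.castHom (𝒢.r_mul β ρ h).symm (f β) := by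
  rw [conv, finsum_eq_single _ ⟨(β, ρ), h, rfl⟩]
  · simp only [convTerm, indic_of_mem hρ, map_one, mul_one]
  · intro q hq
    have : 𝒪.indic C q.1.2 = 0 := by
      refine indic_of_notMem fun hqC => hq (factor_ext_right (hC hqC hρ ?_))
      rw [← 𝒢.d_mul _ _ q.2.1, q.2.2, 𝒢.d_mul _ _ h]
    simp only [convTerm, this, map_zero, mul_zero]

theorem conv_indic_unit_right (f : 𝒪.Sections) {V : Set X} {γ : G} (hγ : 𝒢.d γ ∈ V) :
    conv f (𝒪.indic (𝒢.unit '' V)) γ = f γ := by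
  have hd : InjOn 𝒢.d (𝒢.unit '' V) := by
    rintro _ ⟨x, -, rfl⟩ _ ⟨y, -, rfl⟩ h
    rw [𝒢.d_unit, 𝒢.d_unit] at h
    rw [h]
  rw [← castHom_apply (conv f _) (𝒢.mul_unit γ) (by rw [𝒢.mul_unit]),
    conv_indic_apply_mul f hd ⟨_, hγ, rfl⟩ (𝒢.r_unit _).symm]
  rfl

theorem conv_indic_unit_right_of_notMem (f : 𝒪.Sections) {V : Set X} {γ : G}
    (hγ : 𝒢.d γ ∉ V) : conv f (𝒪.indic (𝒢.unit '' V)) γ = 0 := by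
  refine conv_apply_eq_zero_right fun ρ hρ => indic_of_notMem ?_
  rintro ⟨x, hx, rfl⟩
  rw [𝒢.d_unit] at hρ
  exact hγ (hρ ▸ hx)

theorem conv_indic_indic {B C : Set G} (hB : 𝒢.IsCompactOpenBisection B)
    (hC : 𝒢.IsCompactOpenBisection C) :
    conv (𝒪.indic B) (𝒪.indic C) = 𝒪.indic (𝒢.setMul B C) := by
  funext γ
  by_cases hγ : γ ∈ 𝒢.setMul B C
  · rw [indic_of_mem hγ]
    obtain ⟨β, hβ, ρ, hρ, h, rfl⟩ := hγ
    rw [conv_indic_apply_mul _ hC.2.2.1 hρ h, indic_of_mem hβ, map_one]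
  · rw [indic_of_notMem hγ,
      conv_apply_of_notMem (𝒪.isSupportedOn_indic hB) (𝒪.isSupportedOn_indic hC) hγ]

/-! ### Restriction to the unit space and corners. -/

/-- The restriction of `f` to the unit space. -/
def restrictUnit (f : 𝒪.Sections) (x : X) : 𝒪.Stalk x := 𝒪.castHom (𝒢.r_unit x) (f (𝒢.unit x))

theorem restrictUnit_r (f : 𝒪.Sections) {γ : G} (hγ : 𝒢.unit (𝒢.r γ) = γ) :
    restrictUnit f (𝒢.r γ) = f γ :=
  castHom_apply f hγ _

/-- The Hausdorff hypothesis on `G` enters here: a compact bisection is closed, so a generator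
vanishes on a neighbourhood of every arrow outside it and its extension by zero is continuous. -/
theorem continuousAt_restrictUnit [T2Space G] {f : 𝒪.Sections} (hf : f ∈ 𝒪.Gammac) (x : X) :
    ContinuousAt (fun y => (restrictUnit f y : E)) x := by
  induction hf using AddSubgroup.closure_induction with
  | mem f hf =>
    obtain ⟨B, ⟨hBc, hBo, -⟩, hf, h0⟩ := hf
    by_cases hx : 𝒢.unit x ∈ B
    · exact ContinuousAt.comp (f := 𝒢.unit) (g := fun γ => (f γ : E))
        (hf.continuousAt (hBo.mem_nhds hx)) 𝒢.continuous_unit.continuousAt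
    · refine (𝒪.continuousAt_zero x).congr ?_
      filter_upwards [(hBc.isClosed.isOpen_compl.preimage 𝒢.continuous_unit).mem_nhds hx] with y hy
      rw [restrictUnit, h0 _ hy, map_zero]
  | zero =>
    simpa only [restrictUnit, Pi.zero_apply, map_zero] using 𝒪.continuousAt_zero x
  | add f g _ _ hf hg =>
    simpa only [restrictUnit, Pi.add_apply, map_add] using continuousAt_add hf hg
  | neg f _ hf =>
    simpa only [restrictUnit, Pi.neg_apply, map_neg] using continuousAt_neg hf

/-- If the groupoid is effective, the isotropy arrows in the support of `f`, other than units, lie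
over a closed set with empty interior. -/
theorem exists_isCompact_of_isEffective [T2Space X] [T2Space G] (heff : 𝒢.IsEffective)
    {f : 𝒪.Sections} (hf : f ∈ 𝒪.Gammac) :
    ∃ K : Set G, IsCompact K ∧ (∀ γ, γ ∉ K → γ ∉ range 𝒢.unit → f γ = 0) ∧
      IsClosed (𝒢.d '' (K ∩ {γ | 𝒢.d γ = 𝒢.r γ})) ∧
      interior (𝒢.d '' (K ∩ {γ | 𝒢.d γ = 𝒢.r γ})) = ∅ := by
  have hd := 𝒢.isLocalHomeomorph_d.continuous
  have hiso : IsClosed {γ | 𝒢.d γ = 𝒢.r γ} := isClosed_eq hd 𝒢.isLocalHomeomorph_r.continuous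
  induction hf using AddSubgroup.closure_induction with
  | mem f hf =>
    obtain ⟨B, ⟨hBc, hBo, hBd, -⟩, -, h0⟩ := hf
    have huo : IsOpen (range 𝒢.unit) := EtaleGroupoid.isOpenMap_unit.isOpen_range
    have huc : IsClosed (range 𝒢.unit) := by
      have : range 𝒢.unit = {γ | 𝒢.unit (𝒢.d γ) = γ} := by
        ext γ
        refine ⟨?_, fun h => ⟨_, h⟩⟩
        rintro ⟨x, rfl⟩
        exact congrArg 𝒢.unit (𝒢.d_unit x)
      rw [this]
      exact isClosed_eq (𝒢.continuous_unit.comp hd) continuous_id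
    -- Units form an open set, so removing them keeps compactness; they also form a closed set,
    -- which below makes `B \ range 𝒢.unit` open.
    have hK : IsCompact (B \ range 𝒢.unit) := hBc.diff huo
    refine ⟨B \ range 𝒢.unit, hK, fun γ h h' => h0 γ fun hγ => h ⟨hγ, h'⟩,
      ((hK.inter_right hiso).image hd).isClosed, ?_⟩
    rw [interior_eq_empty_iff_dense_compl, dense_iff_inter_open]
    rintro W hW ⟨x, hx⟩
    by_contra hne
    have hsub : W ⊆ 𝒢.d '' (B \ range 𝒢.unit ∩ {γ | 𝒢.d γ = 𝒢.r γ}) := by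
      intro y hy
      by_contra hy'
      exact hne ⟨y, hy, hy'⟩
    obtain ⟨γ, ⟨hγ, -⟩, rfl⟩ := hsub hx
    -- If `W` lay in the image, injectivity of `d` on `B` would make every arrow of `B \ range
    -- 𝒢.unit` over `W` an isotropy arrow, and effectiveness would make it a unit.
    refine hγ.2 (heff ((B \ range 𝒢.unit) ∩ 𝒢.d ⁻¹' W)
      ((hBo.sdiff huc).inter (hW.preimage hd)) ?_ ⟨hγ, hx⟩)
    rintro β ⟨hβ, hβW⟩
    obtain ⟨ρ, ⟨hρ, hρi⟩, h⟩ := hsub hβW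
    rwa [← hBd hρ.1 hβ.1 h]
  | zero => exact ⟨∅, isCompact_empty, fun _ _ _ => rfl, by simp, by simp⟩
  | add f g _ _ hf hg =>
    obtain ⟨K, hK, h0, hc, hi⟩ := hf
    obtain ⟨L, hL, h0', hc', hi'⟩ := hg
    refine ⟨K ∪ L, hK.union hL, fun γ h h' => ?_, ?_, ?_⟩
    · rw [Pi.add_apply, h0 γ (fun hγ => h (.inl hγ)) h', h0' γ (fun hγ => h (.inr hγ)) h', add_zero]
    · rw [union_inter_distrib_right, image_union]
      exact hc.union hc'
    -- A union of two sets with empty interior has empty interior when one is closed; this is why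
    -- closedness is carried through the induction.
    · rw [union_inter_distrib_right, image_union, interior_union_isClosed_of_interior_empty hc hi',
        hi]
  | neg f _ hf =>
    obtain ⟨K, hK, h0, hci⟩ := hf
    exact ⟨K, hK, fun γ h h' => by rw [Pi.neg_apply, h0 γ h h', neg_zero], hci⟩

/-- If `f` does not vanish on the unit space, then some corner `1_V f 1_V` is supported on the unit
space and has no zeros on `V`. -/
theorem exists_corner [T2Space X] [T2Space G]
    (hX : TopologicalSpace.IsTopologicalBasis {C : Set X | IsCompact C ∧ IsOpen C})
    (heff : 𝒢.IsEffective) (h𝒪 : 𝒪.IsSheafOfFields) {f : 𝒪.Sections} (hf : f ∈ 𝒪.Gammac) {x : X}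
    (hx : restrictUnit f x ≠ 0) :
    ∃ V : Set X, IsCompact V ∧ IsOpen V ∧ V.Nonempty ∧ (∀ y ∈ V, restrictUnit f y ≠ 0) ∧
      ∀ γ, 𝒢.d γ ∈ V → 𝒢.r γ ∈ V → γ ∉ range 𝒢.unit → f γ = 0 := by
  obtain ⟨K, hK, h0, -, hi⟩ := exists_isCompact_of_isEffective heff hf
  have hO : IsOpen {y | restrictUnit f y ≠ 0} := isOpen_iff_mem_nhds.2 fun y hy =>
    (eventually_ne_zero_and_continuousAt_stalkInv h𝒪 (continuousAt_restrictUnit hf y) hy).1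
  -- The nonvanishing set is open and non-empty, so it meets the dense complement of the exceptional
  -- set.
  obtain ⟨y, hy, hyK⟩ := (interior_eq_empty_iff_dense_compl.1 hi).inter_open_nonempty _ hO ⟨x, hx⟩
  have hdr : Continuous fun γ => (𝒢.d γ, 𝒢.r γ) :=
    𝒢.isLocalHomeomorph_d.continuous.prodMk 𝒢.isLocalHomeomorph_r.continuous
  -- No arrow of `K` goes from `y` to `y`, and the image of `K` under `(d, r)` is closed, so no
  -- arrow of `K` stays within a small neighbourhood of `y`.
  have hyy : (y, y) ∈ ((fun γ => (𝒢.d γ, 𝒢.r γ)) '' K)ᶜ := by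
    rintro ⟨γ, hγ, h⟩
    obtain ⟨h1, h2⟩ := Prod.mk.inj h
    exact hyK ⟨γ, ⟨hγ, h1.trans h2.symm⟩, h1⟩
  obtain ⟨U, W, hU, hW, hyU, hyW, hUW⟩ := isOpen_prod_iff.1
    (hK.image hdr).isClosed.isOpen_compl y y hyy
  obtain ⟨V, ⟨hVc, hVo⟩, hyV, hV⟩ := hX.exists_subset_of_mem_open
    (show y ∈ {y | restrictUnit f y ≠ 0} ∩ (U ∩ W) from ⟨hy, hyU, hyW⟩) (hO.inter (hU.inter hW))
  exact ⟨V, hVc, hVo, ⟨y, hyV⟩, fun z hz => (hV hz).1, fun γ h1 h2 => h0 γ fun hγ =>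
    hUW ⟨(hV h1).2.1, (hV h2).2.2⟩ ⟨γ, hγ, rfl⟩⟩

/-! ### Two-sided ideals: minimality and simplicity. -/

variable (𝒪) in
/-- The characteristic function of a compact open bisection, as an element of `Γ_c(𝒢, 𝒪)`. -/
noncomputable def indicGammac {B : Set G} (hB : 𝒢.IsCompactOpenBisection B) : 𝒪.Gammac :=
  ⟨𝒪.indic B, (𝒪.isSupportedOn_indic hB).mem_Gammac⟩

theorem indicGammac_ne_zero (h𝒪 : 𝒪.IsSheafOfFields) {B : Set G}
    (hB : 𝒢.IsCompactOpenBisection B) (hn : B.Nonempty) : 𝒪.indicGammac hB ≠ 0 := by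
  obtain ⟨γ, hγ⟩ := hn
  exact fun h => one_ne_zero h𝒪 _
    ((indic_of_mem hγ).symm.trans (congrFun (congrArg Subtype.val h) γ))

variable [T2Space X]

variable (𝒪) in
/-- The set of `f` vanishing off `r⁻¹(U)`, an ideal if `U` is invariant. -/
noncomputable def idealOfInvariant (U : Set X) (hU : ∀ γ, 𝒢.d γ ∈ U → 𝒢.r γ ∈ U) :
    TwoSidedIdeal 𝒪.Gammac :=
  .mk' {f | ∀ γ, 𝒢.r γ ∉ U → f.1 γ = 0}
    (fun _ _ => rfl)
    (fun {f g} hf hg γ hγ => by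
      change f.1 γ + g.1 γ = 0
      rw [hf γ hγ, hg γ hγ, add_zero])
    (fun {f} hf γ hγ => by
      change -f.1 γ = 0
      rw [hf γ hγ, neg_zero])
    (fun {f g} hg γ hγ => by
      refine finsum_eq_zero_of_forall_eq_zero fun q => ?_
      -- Closure under left multiplication uses invariance: if `r(ρ) = d(β)` were in `U`, then so
      -- would be `r(β) = r(γ)`.
      have : g.1 q.1.2 = 0 := hg _ fun h => hγ (𝒢.r_factor q.2.1 q.2.2 ▸ hU _ (q.2.1 ▸ h))
      simp only [convTerm, this, mul_zero, map_zero])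
    (fun {f g} hf γ hγ => conv_apply_eq_zero_left fun β hβ => hf β (hβ ▸ hγ))

theorem mem_idealOfInvariant {U : Set X} {hU : ∀ γ, 𝒢.d γ ∈ U → 𝒢.r γ ∈ U} {f : 𝒪.Gammac} :
    f ∈ 𝒪.idealOfInvariant U hU ↔ ∀ γ, 𝒢.r γ ∉ U → f.1 γ = 0 :=
  TwoSidedIdeal.mem_mk' ..

/-- The field hypothesis serves only to give `1 ≠ 0` in the stalks. -/
theorem isMinimal_of_isSimpleRing
    (hX : TopologicalSpace.IsTopologicalBasis {C : Set X | IsCompact C ∧ IsOpen C})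
    (h𝒪 : 𝒪.IsSheafOfFields) [IsSimpleRing 𝒪.Gammac] : 𝒢.IsMinimal := by
  intro U hUo hU
  by_contra! hne
  obtain ⟨⟨x, hx⟩, h2⟩ := hne
  obtain ⟨y, hy⟩ := (ne_univ_iff_exists_notMem U).1 h2
  rcases eq_bot_or_eq_top (𝒪.idealOfInvariant U hU) with h | h
  · obtain ⟨V, ⟨hVc, hVo⟩, hxV, hVU⟩ := hX.exists_subset_of_mem_open hx hUo
    have hB := EtaleGroupoid.isCompactOpenBisection_image_unit (𝒢 := 𝒢) hVc hVo
    have hm : 𝒪.indicGammac hB ∈ 𝒪.idealOfInvariant U hU := mem_idealOfInvariant.2 fun γ hγ =>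
      indic_of_notMem fun h => hγ (hVU (EtaleGroupoid.mem_image_unit.1 h).1)
    rw [h, TwoSidedIdeal.mem_bot] at hm
    exact indicGammac_ne_zero h𝒪 hB ⟨_, x, hxV, rfl⟩ hm
  · obtain ⟨V, ⟨hVc, hVo⟩, hyV, -⟩ := hX.exists_subset_of_mem_open (mem_univ y) isOpen_univ
    have hB := EtaleGroupoid.isCompactOpenBisection_image_unit (𝒢 := 𝒢) hVc hVo
    have hm : 𝒪.indicGammac hB ∈ 𝒪.idealOfInvariant U hU := h ▸ TwoSidedIdeal.mem_top _
    have hm' : 𝒢.unit y ∈ 𝒢.unit '' V := ⟨y, hyV, rfl⟩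
    exact one_ne_zero h𝒪 _ ((indic_of_mem hm').symm.trans
      (mem_idealOfInvariant.1 hm (𝒢.unit y) (by rwa [𝒢.r_unit])))

/-- A nonzero ideal contains the characteristic function of a nonempty set of units. -/
theorem exists_indic_mem [T2Space G]
    (hX : TopologicalSpace.IsTopologicalBasis {C : Set X | IsCompact C ∧ IsOpen C})
    (heff : 𝒢.IsEffective) (h𝒪 : 𝒪.IsSheafOfFields) {I : TwoSidedIdeal 𝒪.Gammac} (hI : I ≠ ⊥) :
    ∃ (V : Set X) (hc : IsCompact V) (ho : IsOpen V), V.Nonempty ∧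
      𝒪.indicGammac (EtaleGroupoid.isCompactOpenBisection_image_unit hc ho) ∈ I := by
  obtain ⟨f, hf, γ, hγ⟩ : ∃ f ∈ I, ∃ γ, f.1 γ ≠ 0 := by
    by_contra! h
    refine hI (le_bot_iff.1 fun f hf => ?_)
    rw [TwoSidedIdeal.mem_bot]
    exact Subtype.ext (funext fun γ => h f hf γ)
  obtain ⟨B, hB, hγB, -⟩ := EtaleGroupoid.exists_isCompactOpenBisection hX γ isOpen_univ
    (mem_univ _)
  -- Multiplying by the characteristic function of `B⁻¹` moves the nonzero value at `γ` to the unit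
  -- `γγ⁻¹`.
  have hg := I.mul_mem_right f (𝒪.indicGammac hB.inv) hf
  set g := f * 𝒪.indicGammac hB.inv
  have hgx : restrictUnit g.1 (𝒢.r γ) ≠ 0 := by
    have h1 : g.1 (𝒢.mul γ (𝒢.inv γ)) = 𝒪.castHom (𝒢.r_mul _ _ (𝒢.r_inv γ).symm).symm (f.1 γ) :=
      conv_indic_apply_mul f.1 hB.inv.2.2.1 ⟨γ, hγB, rfl⟩ (𝒢.r_inv γ).symm
    rw [restrictUnit, ← castHom_apply g.1 (𝒢.mul_inv γ) (by rw [𝒢.mul_inv]), h1]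
    exact fun h => hγ (Subtype.ext (congrArg Subtype.val h :))
  obtain ⟨V, hVc, hVo, hVn, hV0, hV⟩ := exists_corner hX heff h𝒪 g.2 hgx
  refine ⟨V, hVc, hVo, hVn, ?_⟩
  have hB' := EtaleGroupoid.isCompactOpenBisection_image_unit (𝒢 := 𝒢) hVc hVo
  have hinv : ∀ x ∈ V, ContinuousAt
      (fun y => (stalkInv h𝒪 y (restrictUnit g.1 y) : E)) x := fun x hx =>
    (eventually_ne_zero_and_continuousAt_stalkInv h𝒪 (continuousAt_restrictUnit g.2 x)
      (hV0 x hx)).2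
  have hsupp : IsSupportedOn (pullback (fun y => stalkInv h𝒪 y (restrictUnit g.1 y))
      (𝒢.unit '' V)) (𝒢.unit '' V) := by
    refine isSupportedOn_pullback hB' ?_
    rintro _ ⟨_, ⟨x, hx, rfl⟩, rfl⟩
    rw [𝒢.r_unit]
    exact hinv x hx
  -- The identity is `1_V = h (g 1_V)`, where `h` is the pointwise inverse of `g` on the units of
  -- `V` and zero elsewhere; `h` also restricts ranges to `V`.
  convert I.mul_mem_left ⟨_, hsupp.mem_Gammac⟩ _ (I.mul_mem_right _ (𝒪.indicGammac hB') hg)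
  refine Subtype.ext (funext fun β => ?_)
  change 𝒪.indic (𝒢.unit '' V) β = conv (pullback (fun y => stalkInv h𝒪 y (restrictUnit g.1 y))
    (𝒢.unit '' V)) (conv g.1 (𝒪.indic (𝒢.unit '' V))) β
  by_cases hr : 𝒢.r β ∈ V
  · rw [conv_pullback_unit hVc hVo hinv _ hr]
    by_cases hd : 𝒢.d β ∈ V
    · rw [conv_indic_unit_right _ hd]
      by_cases hu : β ∈ range 𝒢.unit
      · have hu' : 𝒢.unit (𝒢.r β) = β := by
          obtain ⟨x, rfl⟩ := hu
          rw [𝒢.r_unit]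
        rw [indic_of_mem (EtaleGroupoid.mem_image_unit.2 ⟨hr, hu'⟩), ← restrictUnit_r g.1 hu',
          (h𝒪 _).mul_comm, mul_stalkInv h𝒪 (hV0 _ hr)]
      · rw [indic_of_notMem fun h => hu (image_subset_range _ _ h), hV β hd hr hu, mul_zero]
    · rw [conv_indic_unit_right_of_notMem _ hd, mul_zero, indic_of_notMem]
      rintro ⟨x, hx, rfl⟩
      rw [𝒢.d_unit] at hd
      exact hd hx
  · rw [indic_of_notMem fun h => hr (EtaleGroupoid.mem_image_unit.1 h).1,
      conv_apply_eq_zero_left fun ρ hρ => hsupp.2.2 ρ fun h =>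
        hr (hρ ▸ (EtaleGroupoid.mem_image_unit.1 h).1)]

/-- The sets of units with characteristic function in a given ideal are closed under unions. -/
theorem indic_union_mem {I : TwoSidedIdeal 𝒪.Gammac} {V W : Set X} (hVc : IsCompact V)
    (hVo : IsOpen V) (hWc : IsCompact W) (hWo : IsOpen W)
    (hV : 𝒪.indicGammac (EtaleGroupoid.isCompactOpenBisection_image_unit hVc hVo) ∈ I)
    (hW : 𝒪.indicGammac (EtaleGroupoid.isCompactOpenBisection_image_unit hWc hWo) ∈ I) :
    𝒪.indicGammac (EtaleGroupoid.isCompactOpenBisection_image_unit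
      (hVc.union hWc) (hVo.union hWo)) ∈ I := by
  -- Inclusion–exclusion: the characteristic function of the union is `1_V + 1_W - 1_V 1_W`.
  convert I.sub_mem (I.add_mem hV hW) (I.mul_mem_right _ (𝒪.indicGammac
    (EtaleGroupoid.isCompactOpenBisection_image_unit hWc hWo)) hV)
  refine Subtype.ext (funext fun γ => ?_)
  change 𝒪.indic _ γ = 𝒪.indic (𝒢.unit '' V) γ + 𝒪.indic (𝒢.unit '' W) γ -
    conv (𝒪.indic (𝒢.unit '' V)) (𝒪.indic (𝒢.unit '' W)) γ
  by_cases hγ : 𝒢.r γ ∈ V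
  · rw [conv_indic_unit hVc hVo _ hγ, add_sub_cancel_right]
    by_cases hu : 𝒢.unit (𝒢.r γ) = γ
    · rw [indic_of_mem (EtaleGroupoid.mem_image_unit.2 ⟨.inl hγ, hu⟩),
        indic_of_mem (EtaleGroupoid.mem_image_unit.2 ⟨hγ, hu⟩)]
    · rw [indic_of_notMem fun h => hu (EtaleGroupoid.mem_image_unit.1 h).2,
        indic_of_notMem fun h => hu (EtaleGroupoid.mem_image_unit.1 h).2]
  · rw [conv_indic_unit_of_notMem _ hγ, sub_zero,
      indic_of_notMem (B := 𝒢.unit '' V) fun h => hγ (EtaleGroupoid.mem_image_unit.1 h).1, zero_add]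
    by_cases hm : γ ∈ 𝒢.unit '' W
    · rw [indic_of_mem hm, indic_of_mem (image_mono subset_union_right hm)]
    · rw [indic_of_notMem hm, indic_of_notMem]
      rw [image_union]
      rintro (h | h)
      · exact hγ (EtaleGroupoid.mem_image_unit.1 h).1
      · exact hm h

theorem eq_top_of_isMinimal
    (hX : TopologicalSpace.IsTopologicalBasis {C : Set X | IsCompact C ∧ IsOpen C})
    (hmin : 𝒢.IsMinimal) {I : TwoSidedIdeal 𝒪.Gammac} {V : Set X} (hc : IsCompact V)
    (ho : IsOpen V) (hn : V.Nonempty)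
    (hV : 𝒪.indicGammac (EtaleGroupoid.isCompactOpenBisection_image_unit hc ho) ∈ I) : I = ⊤ := by
  let P : Set X → Prop := fun W => ∃ (hc : IsCompact W) (ho : IsOpen W),
    𝒪.indicGammac (EtaleGroupoid.isCompactOpenBisection_image_unit hc ho) ∈ I
  have hcover : ∀ x, ∃ W, P W ∧ x ∈ W := by
    have hO : IsOpen {x | ∃ W, P W ∧ x ∈ W} := isOpen_iff_forall_mem_open.2 fun x ⟨W, hW, hx⟩ =>
      ⟨W, fun y hy => ⟨W, hW, hy⟩, hW.2.1, hx⟩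
    have hinv : ∀ γ, 𝒢.d γ ∈ {x | ∃ W, P W ∧ x ∈ W} → 𝒢.r γ ∈ {x | ∃ W, P W ∧ x ∈ W} := by
      rintro γ ⟨W, ⟨hWc, hWo, hW⟩, hγ⟩
      obtain ⟨B, hB, hγB, hBW⟩ := EtaleGroupoid.exists_isCompactOpenBisection hX γ hWo hγ
      refine ⟨𝒢.r '' B, ⟨hB.1.image 𝒢.isLocalHomeomorph_r.continuous,
        𝒢.isLocalHomeomorph_r.isOpenMap _ hB.2.1, ?_⟩, ⟨γ, hγB, rfl⟩⟩
      -- As `d(B) ⊆ W`, conjugating gives `1_B 1_W 1_{B⁻¹} = 1_B 1_{B⁻¹} = 1_{r(B)}`.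
      convert I.mul_mem_right _ (𝒪.indicGammac hB.inv) (I.mul_mem_left (𝒪.indicGammac hB) _ hW)
      refine Subtype.ext ?_
      have h1 : conv (𝒪.indic B) (𝒪.indic (𝒢.unit '' W)) = 𝒪.indic B := by
        funext β
        by_cases hβ : 𝒢.d β ∈ W
        · exact conv_indic_unit_right _ hβ
        · rw [conv_indic_unit_right_of_notMem _ hβ, indic_of_notMem fun h => hβ (hBW h)]
      change 𝒪.indic _ = conv (conv (𝒪.indic B) (𝒪.indic (𝒢.unit '' W))) (𝒪.indic (𝒢.inv '' B))
      rw [h1, conv_indic_indic hB hB.inv, EtaleGroupoid.setMul_image_inv hB.2.2.1]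
    rcases hmin _ hO hinv with h | h
    · obtain ⟨x, hx⟩ := hn
      have hxP : x ∈ {x | ∃ W, P W ∧ x ∈ W} := ⟨V, ⟨hc, ho, hV⟩, hx⟩
      rw [h] at hxP
      exact hxP.elim
    · exact fun x => h.symm.subset (mem_univ x)
  -- The ring need not have a unit when `X` is not compact, so local units `1_W` over compact sets
  -- take its place.
  have hcompact : ∀ K, IsCompact K → ∃ W, P W ∧ K ⊆ W := by
    intro K hK
    refine hK.induction_on ⟨∅, ⟨isCompact_empty, isOpen_empty, ?_⟩, subset_rfl⟩
      (fun s t hst ⟨W, hW, h⟩ => ⟨W, hW, hst.trans h⟩) ?_ fun x _ => ?_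
    · convert I.zero_mem
      exact Subtype.ext (funext fun γ => indic_of_notMem (by simp))
    · rintro s t ⟨W, ⟨hWc, hWo, hW⟩, hs⟩ ⟨W', ⟨hWc', hWo', hW'⟩, ht⟩
      exact ⟨W ∪ W', ⟨hWc.union hWc', hWo.union hWo', indic_union_mem hWc hWo hWc' hWo' hW hW'⟩,
        union_subset_union hs ht⟩
    · obtain ⟨W, hW, hx⟩ := hcover x
      exact ⟨W, mem_nhdsWithin_of_mem_nhds (hW.2.1.mem_nhds hx), W, hW, subset_rfl⟩
  suffices h : ∀ f : 𝒪.Gammac, f ∈ I from top_le_iff.1 fun f _ => h f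
  rintro ⟨f, hf⟩
  induction hf using AddSubgroup.closure_induction with
  | mem f hf =>
    obtain ⟨B, hB, hfc, h0⟩ := hf
    obtain ⟨W, ⟨hWc, hWo, hW⟩, hBW⟩ := hcompact _ (hB.1.image 𝒢.isLocalHomeomorph_r.continuous)
    -- `f = 1_W f`, because every arrow in the support of `f` has its range in `W`.
    convert I.mul_mem_right _ ⟨f, AddSubgroup.subset_closure ⟨B, hB, hfc, h0⟩⟩ hW
    refine Subtype.ext (funext fun γ => ?_)
    by_cases hγ : 𝒢.r γ ∈ W
    · exact (conv_indic_unit hWc hWo f hγ).symm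
    · exact (h0 γ fun h => hγ (hBW ⟨γ, h, rfl⟩)).trans (conv_indic_unit_of_notMem f hγ).symm
  | zero => exact I.zero_mem
  | add f g hf hg ihf ihg => exact I.add_mem ihf ihg
  | neg f hf ihf => exact I.neg_mem ihf

/-- For an effective Hausdorff ample groupoid and a sheaf of fields on it, minimality is equivalent
to simplicity of the ring of sections with compact support. -/
theorem isMinimal_iff_isSimpleRing [T2Space G] [Nonempty X]
    (hX : TopologicalSpace.IsTopologicalBasis {C : Set X | IsCompact C ∧ IsOpen C})
    (heff : 𝒢.IsEffective) (h𝒪 : 𝒪.IsSheafOfFields) :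
    𝒢.IsMinimal ↔ IsSimpleRing 𝒪.Gammac := by
  refine ⟨fun hmin => ⟨?_⟩, fun _ => isMinimal_of_isSimpleRing hX h𝒪⟩
  have : Nontrivial 𝒪.Gammac := by
    obtain ⟨x⟩ := ‹Nonempty X›
    obtain ⟨V, ⟨hVc, hVo⟩, hxV, -⟩ := hX.exists_subset_of_mem_open (mem_univ x) isOpen_univ
    exact ⟨_, 0, indicGammac_ne_zero h𝒪
      (EtaleGroupoid.isCompactOpenBisection_image_unit hVc hVo) ⟨_, x, hxV, rfl⟩⟩
  refine { eq_bot_or_eq_top := fun I => or_iff_not_imp_left.2 fun hI => ?_ }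
  obtain ⟨V, hc, ho, hn, hV⟩ := exists_indic_mem hX heff h𝒪 hI
  exact eq_top_of_isMinimal hX hmin hc ho hn hV

end GroupoidSheafOfRings

/-! ### Translation to actions of inverse semigroups. -/

namespace InvSemigroupAction

variable {S X : Type*} [InverseSemigroup S] [TopologicalSpace X] {A : InvSemigroupAction S X}

/-- A basic open set of isotropy germs `[s, y]` puts its base points in the interior of the fixed
points of `θ_s`. Topological freeness then supplies an idempotent `e ≤ s` with `[s, x] = [e, x]`, a
unit. -/
theorem isEffective_groupoid (hA : A.IsTopologicallyFree) : A.groupoid.IsEffective := by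
  intro W hW hiso
  refine A.germ_ind fun s x hx hxW => ?_
  obtain ⟨U, hU, hxU, hUW⟩ := A.isOpen_germ_iff.1 hW s x hx hxW
  have hint : x ∈ interior {y | y ∈ (A.θ s).source ∧ A.θ s y = y} :=
    mem_interior.2 ⟨U ∩ (A.θ s).source, fun y hy =>
      ⟨hy.2, (hiso _ (hUW ⟨y, hy.2, hy.1, rfl⟩)).symm⟩, hU.inter (A.θ s).open_source, hxU, hx⟩
  rw [hA s] at hint
  obtain ⟨-, e, he, hes, hxe⟩ := hint
  -- Topological freeness speaks of the range `X_e`; since `θ_e` is the identity on its domain, its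
  -- range lies in that domain.
  have hxe' : x ∈ (A.θ e).source := by
    have h := (A.θ e).map_target hxe
    have h' := A.apply_idem he h
    rw [(A.θ e).right_inv hxe] at h'
    rwa [h']
  refine ⟨x, ?_⟩
  rw [← A.germ_eq_of_le hes hxe']
  exact Germ.unit_eq A he hxe'

theorem isMinimal_groupoid_iff : A.groupoid.IsMinimal ↔ A.IsMinimal := by
  have h : ∀ U : Set X, (∀ γ, A.groupoid.d γ ∈ U → A.groupoid.r γ ∈ U) ↔ A.IsInvariant U := by
    intro U
    constructor
    · rintro h s _ ⟨x, ⟨hxU, hx⟩, rfl⟩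
      exact h (A.germ s x hx) hxU
    · exact fun h => A.germ_ind fun s x hx hxU => h s ⟨x, ⟨hxU, hx⟩, rfl⟩
  simp only [EtaleGroupoid.IsMinimal, IsMinimal, h]

end InvSemigroupAction

/-- A clopen set inside a compact neighbourhood is compact. -/
theorem isTopologicalBasis_isCompact_isOpen {X : Type*} [TopologicalSpace X]
    [LocallyCompactSpace X] (hX : TopologicalSpace.IsTopologicalBasis {U : Set X | IsClopen U}) :
    TopologicalSpace.IsTopologicalBasis {C : Set X | IsCompact C ∧ IsOpen C} := by
  refine TopologicalSpace.isTopologicalBasis_of_isOpen_of_nhds (fun C hC => hC.2)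
    fun x U hx hU => ?_
  obtain ⟨K, hK, hKU, hKc⟩ := local_compact_nhds (hU.mem_nhds hx)
  obtain ⟨C, hC, hxC, hCK⟩ := hX.mem_nhds_iff.1 hK
  exact ⟨C, ⟨hKc.of_isClosed_subset hC.isClosed hCK, hC.isOpen⟩, hxC, hCK.trans hKU⟩

theorem mainTheorem12 {S X E : Type*} [InverseSemigroup S] [TopologicalSpace X]
    [LocallyCompactSpace X] [T2Space X] [Nonempty X] [TopologicalSpace E]
    (hX : TopologicalSpace.IsTopologicalBasis {U : Set X | IsClopen U})
    (θ : InvSemigroupAction S X) (hθ : θ.IsTopologicallyFree) [T2Space θ.Germ]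
    (𝒪 : GroupoidSheafOfRings θ.groupoid E) (h𝒪 : 𝒪.IsSheafOfFields) :
    θ.IsMinimal ↔ IsSimpleRing 𝒪.Gammac :=
  InvSemigroupAction.isMinimal_groupoid_iff.symm.trans
    (GroupoidSheafOfRings.isMinimal_iff_isSimpleRing (isTopologicalBasis_isCompact_isOpen hX)
      (InvSemigroupAction.isEffective_groupoid hθ) h𝒪)
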